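/- Let $p\ge 1$ be an integer and let $e_1,\dots,e_p$, $d_1,\dots,d_p$ be real numbers with $$0<e_1\le\dots\le e_p,\qquad -p<d_1\le\dots\le d_p,\qquad d_1\cdots d_p=0,\qquad 1<\frac{E-D}{p}<p-1,$$ where $E=\sum_j e_j$ and $D=\sum_j d_j$ (the last condition forces $p\ge 3$). Consider the birth and death rates $$\lambda_n=(pn+e_1)\cdots(pn+e_p),\qquad \mu_n=(pn+d_1)\cdots(pn+d_p),\qquad n\ge 0,$$ and the associated Stieltjes moment problem, that is, the moment problem with Jacobi parameters $a_n=\lambda_n+\mu_n$ and $b_n=\sqrt{\lambda_n\mu_{n+1}}$. Its orthonormal polynomials $P_n$ and its polynomials of the second kind $Q_n$ are the solutions of $$z\,r_n(z)=b_nr_{n+1}(z)+a_nr_n(z)+b_{n-1}r_{n-1}(z),\quad n\ge 0,\qquad b_{-1}:=1,$$ with initial values $P_{-1}=0$, $P_0=1$ and $Q_{-1}=-1$, $Q_0=0$. The problem is called indeterminate if $\sum_n|P_n(z)|^2$ and $\sum_n|Q_n(z)|^2$ converge for all $z\in\mathbb C$; its Nevanlinna matrix then consists of the four entire functions $$A(z)=z\sum_{k\ge0}Q_k(0)Q_k(z),\quad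 B(z)=-1+z\sum_{k\ge0}Q_k(0)P_k(z),$$ $$C(z)=1+z\sum_{k\ge0}P_k(0)Q_k(z),\quad D(z)=z\sum_{k\ge0}P_k(0)P_k(z).$$ For an entire function $f$ put $M_f(r)=\max_{|z|=r}|f(z)|$. The order of $f$ is $\rho_f=\limsup_{r\to\infty}\frac{\log\log M_f(r)}{\log r}$ and, if $0<\rho_f<\infty$, its type is $\tau_f=\limsup_{r\to\infty}\frac{\log M_f(r)}{r^{\rho_f}}$. The order and the type of the moment problem are the common order and the common type of $A,B,C,D$. **Theorem.** 1. The moment problem above is indeterminate, it has order $1/p$, and its type $\tau$ satisfies $$\frac{\pi}{p\sin(\pi/p)}\le\tau\le\frac{\pi}{p\sin(\pi/p)\cos(\pi/p)}.$$ 2. For every integer $p\ge 3$, Valent's conjectured value $T_p=\int_0^1\frac{du}{(1-u^p)^{2/p}}$ is a convergent integral and $$\frac{\pi}{p\sin(\pi/p)}\le T_p\le\frac{\pi}{p\sin(\pi/p)\cos(\pi/p)}.$$ 3. Consequently the conjectured type is asymptotically correct: $\tau/T_p\to 1$ as $p\to\infty$, uniformly in the parameters $e_j,d_j$ subject to the conditions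 above. That is, for every $\varepsilon>0$ there is $p_0$ such that $|\tau/T_p-1|<\varepsilon$ for all $p\ge p_0$ and all such parameters. -/

import Mathlib

open Filter

noncomputable section

namespace ValentMoment

/-- The polynomials `P_n` of the recurrence
`z r_n = b_n r_{n+1} + a_n r_n + b_{n-1} r_{n-1}` (`n ≥ 0`, convention `b_{-1} = 1`)
with `P_{-1} = 0`, `P_0 = 1`: the orthonormal polynomials of the moment problem with
Jacobi parameters `a_n`, `b_n`. -/
def P (a b : ℕ → ℝ) : ℕ → ℂ → ℂ
  | 0, _ => 1
  | 1, z => (z - (a 0 : ℂ)) / (b 0 : ℂ)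
  | n + 2, z => ((z - (a (n + 1) : ℂ)) * P a b (n + 1) z - (b n : ℂ) * P a b n z)
      / (b (n + 1) : ℂ)

/-- The polynomials of the second kind: the same recurrence, with `Q_{-1} = -1`, `Q_0 = 0`
(hence `Q_1 = 1 / b_0`). -/
def Q (a b : ℕ → ℝ) : ℕ → ℂ → ℂ
  | 0, _ => 0
  | 1, _ => 1 / (b 0 : ℂ)
  | n + 2, z => ((z - (a (n + 1) : ℂ)) * Q a b (n + 1) z - (b n : ℂ) * Q a b n z)
      / (b (n + 1) : ℂ)

/-- The indeterminate case: `∑ |P_n(z)|²` and `∑ |Q_n(z)|²` converge for every complex `z`. -/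
def IsIndeterminate (a b : ℕ → ℝ) : Prop :=
  ∀ z : ℂ, (Summable fun n => ‖P a b n z‖ ^ 2) ∧ (Summable fun n => ‖Q a b n z‖ ^ 2)

/-- The entry `A` of the Nevanlinna matrix. -/
def nevA (a b : ℕ → ℝ) (z : ℂ) : ℂ := z * ∑' k, Q a b k 0 * Q a b k z

/-- The entry `B` of the Nevanlinna matrix. -/
def nevB (a b : ℕ → ℝ) (z : ℂ) : ℂ := -1 + z * ∑' k, Q a b k 0 * P a b k z

/-- The entry `C` of the Nevanlinna matrix. -/
def nevC (a b : ℕ → ℝ) (z : ℂ) : ℂ := 1 + z * ∑' k, P a b k 0 * Q a b k z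

/-- The entry `D` of the Nevanlinna matrix. -/
def nevD (a b : ℕ → ℝ) (z : ℂ) : ℂ := z * ∑' k, P a b k 0 * P a b k z

/-- The maximum modulus `max_{|z| = r} |f z|`. -/
def maxModulus (f : ℂ → ℂ) (r : ℝ) : ℝ := sSup ((fun z => ‖f z‖) '' Metric.sphere 0 r)

/-- The entire function `f` has order `ρ`:
`limsup_{r → ∞} log log M_f(r) / log r = ρ`. -/
def HasOrder (f : ℂ → ℂ) (ρ : ℝ) : Prop :=
  Differentiable ℂ f ∧
    limsup (fun r : ℝ =>
      ((Real.log (Real.log (maxModulus f r)) / Real.log r : ℝ) : EReal)) atTop = (ρ : EReal)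

/-- The entire function `f` has order `ρ` and, with respect to this order, type `τ`:
`limsup_{r → ∞} log M_f(r) / r ^ ρ = τ`. -/
def HasType (f : ℂ → ℂ) (ρ : ℝ) (τ : EReal) : Prop :=
  HasOrder f ρ ∧
    limsup (fun r : ℝ => ((Real.log (maxModulus f r) / r ^ ρ : ℝ) : EReal)) atTop = τ

/-- The moment problem with Jacobi parameters `a_n`, `b_n` is indeterminate and has order `ρ`,
the common order of the four entries of the Nevanlinna matrix. -/
def HasMomentOrder (a b : ℕ → ℝ) (ρ : ℝ) : Prop :=
  IsIndeterminate a b ∧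
    HasOrder (nevA a b) ρ ∧ HasOrder (nevB a b) ρ ∧
    HasOrder (nevC a b) ρ ∧ HasOrder (nevD a b) ρ

/-- The moment problem with Jacobi parameters `a_n`, `b_n` is indeterminate, its order lies
strictly between `0` and `1`, and its type (the common type of the four entries of the
Nevanlinna matrix, with respect to this order) is `τ`. -/
def HasMomentType (a b : ℕ → ℝ) (τ : EReal) : Prop :=
  IsIndeterminate a b ∧ ∃ ρ : ℝ, 0 < ρ ∧ ρ < 1 ∧
    HasType (nevA a b) ρ τ ∧ HasType (nevB a b) ρ τ ∧
    HasType (nevC a b) ρ τ ∧ HasType (nevD a b) ρ τ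

/-- The polynomial rate `(p n + x_1) ⋯ (p n + x_p)`. -/
def rate (p : ℕ) (x : Fin p → ℝ) (n : ℕ) : ℝ := ∏ j, ((p : ℝ) * n + x j)

/-- `a_n = λ_n + μ_n` for the birth rates `λ = rate p e` and death rates `μ = rate p d`. -/
def jacobiA (p : ℕ) (e d : Fin p → ℝ) (n : ℕ) : ℝ := rate p e n + rate p d n

/-- `b_n = √(λ_n μ_{n+1})` for the birth rates `λ = rate p e` and death rates `μ = rate p d`. -/
def jacobiB (p : ℕ) (e d : Fin p → ℝ) (n : ℕ) : ℝ := √(rate p e n * rate p d (n + 1))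

/-- The conditions on the parameters:
`0 < e_1 ≤ ⋯ ≤ e_p`, `-p < d_1 ≤ ⋯ ≤ d_p`, `d_1 ⋯ d_p = 0` and `1 < (E - D) / p < p - 1`,
where `E = ∑ e_j`, `D = ∑ d_j`. (The last one forces `p ≥ 3`.) -/
structure Admissible (p : ℕ) (e d : Fin p → ℝ) : Prop where
  e_mono : Monotone e
  e_pos : ∀ j, 0 < e j
  d_mono : Monotone d
  d_gt : ∀ j, -(p : ℝ) < d j
  d_prod : ∏ j, d j = 0
  indet_left : 1 < ((∑ j, e j) - ∑ j, d j) / (p : ℝ)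
  indet_right : ((∑ j, e j) - ∑ j, d j) / (p : ℝ) < (p : ℝ) - 1

/-- The integrand `(1 - u ^ p) ^ (-2 / p)` of Valent's conjectured type. -/
def valentIntegrand (p : ℕ) (u : ℝ) : ℝ := 1 / (1 - u ^ p) ^ (2 / (p : ℝ))

/-- Valent's conjectured type `∫₀¹ (1 - u ^ p) ^ (-2 / p) du`. -/
def valentIntegral (p : ℕ) : ℝ := ∫ u in (0 : ℝ)..1, valentIntegrand p u

/-- The lower bound `π / (p sin (π / p))`. -/
def lowerBound (p : ℕ) : ℝ := Real.pi / (p * Real.sin (Real.pi / p))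

/-- The upper bound `π / (p sin (π / p) cos (π / p))`. -/
def upperBound (p : ℕ) : ℝ := Real.pi / (p * Real.sin (Real.pi / p) * Real.cos (Real.pi / p))

end ValentMoment

end

/-! The birth and death rates define a discrete string with masses `w n`, the products of `λ_i /
μ_(i+1)`, and lengths `q n = 1 / (λ_n * w n)`. Up to the factor `(-1)^n * √(w n)` and the
substitution `z ↦ -z`, the polynomials `P_n` and `Q_n` are the displacements of this string started
at `(1, 0)` and `(0, 1)`. By Raabe's test, the condition `1 < (E - D) / p < p - 1` makes both total
length and total mass finite; hence indeterminacy.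

The string recursion has nonnegative coefficients when the spectral parameter is `x ≥ 0`, so each
Nevanlinna entry is, up to a bounded term, largest on `|z| = r` at `z = -r`. All four are
comparable, up to powers of `r`, with one positive function, `flux w q r`. Order and type are
therefore read off from `log (flux w q x)`, and only `w n * q n = 1 / λ_n ≈ (p n)^(-p)` matters for
the leading term.

Lower bound: the displacement dominates `∏ (1 + x * w i * q i)`, whose logarithm is compared with `∫
log (1 + x (p t)^(-p)) dt`. Upper bound: with `t n = √(q n / w n)`, the energy `u + (t n / √x) * v`
grows per step by at most `(1 + √x * √(w n * q n))^2` times a harmless `exp (K / (n + 1))`; this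
gives `2 ∫ log (1 + √x (p t)^(-p/2)) dt`. Both integrals come from `integral_log_one_add_rpow_neg`,
with `m = p` and `m = p / 2`, and yield `lowerBound p * x^(1/p)` and `upperBound p * x^(1/p)`. All
errors are `O(1 + log x)` (`PowerString.le_log_flux`, `PowerString.log_flux_le`).

The two bounds are themselves beta integrals that enclose Valent's integral, and their quotient is
`cos (π / p)`, which tends to 1. So any type and the conjectured value agree asymptotically,
uniformly in the parameters. -/

noncomputable section

namespace ValentMoment

/-! ### Beta integrals and the integral of `log (1 + t^(-m))`. -/

section

open MeasureTheory Set Topology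

/-- Euler's reflection formula as a beta integral on the open unit interval. -/
theorem integral_beta_reflection {s : ℝ} (h0 : 0 < s) (h1 : s < 1) :
    IntegrableOn (fun x : ℝ => x ^ (s - 1) * (1 - x) ^ (-s)) (Ioo 0 1) ∧
      ∫ x in Ioo (0 : ℝ) 1, x ^ (s - 1) * (1 - x) ^ (-s) = Real.pi / Real.sin (Real.pi * s) := by
  have key : ∀ x ∈ Ioo (0 : ℝ) 1,
      (x : ℂ) ^ ((s : ℂ) - 1) * (1 - (x : ℂ)) ^ (((1 - s : ℝ) : ℂ) - 1)
        = ((x ^ (s - 1) * (1 - x) ^ (-s) : ℝ) : ℂ) := by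
    intro x hx
    have e : ((1 - s : ℝ) : ℂ) - 1 = ((-s : ℝ) : ℂ) := by push_cast; ring
    rw [e]
    push_cast
    rw [Complex.ofReal_cpow hx.1.le, Complex.ofReal_cpow (by linarith [hx.2])]
    push_cast
    rfl
  have hc := Complex.betaIntegral_convergent (u := (s : ℂ)) (v := ((1 - s : ℝ) : ℂ))
    (by simpa using h0) (by simpa using h1)
  have hv := Complex.betaIntegral_eq_Gamma_mul_div (s : ℂ) ((1 - s : ℝ) : ℂ)
    (by simpa using h0) (by simpa using h1)
  rw [intervalIntegrable_iff_integrableOn_Ioo_of_le zero_le_one] at hc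
  have hc' := (integrableOn_congr_fun key measurableSet_Ioo).1 hc
  constructor
  · have := hc'.re
    simp only [RCLike.re_eq_complex_re, Complex.ofReal_re] at this
    exact this
  · rw [Complex.betaIntegral, intervalIntegral.integral_of_le zero_le_one,
      integral_Ioc_eq_integral_Ioo, setIntegral_congr_fun measurableSet_Ioo key,
      integral_complex_ofReal] at hv
    have e : (s : ℂ) + ((1 - s : ℝ) : ℂ) = 1 := by push_cast; ring
    rw [e, Complex.Gamma_one, div_one] at hv
    have h2 : Complex.Gamma (s : ℂ) * Complex.Gamma ((1 - s : ℝ) : ℂ)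
        = ((Real.Gamma s * Real.Gamma (1 - s) : ℝ) : ℂ) := by
      rw [Complex.Gamma_ofReal, Complex.Gamma_ofReal]; push_cast; rfl
    rw [h2, Real.Gamma_mul_Gamma_one_sub] at hv
    exact_mod_cast hv

/-- Substitution `x = u^p` in the beta integral. The choices `s = 1/p` and `s = 2/p` turn the factor
`u^(p s - 1)` into `1` and `u`, giving the lower and the upper bound. -/
theorem integral_one_sub_pow {p : ℕ} (hp : 1 ≤ p) {s : ℝ} (h0 : 0 < s) (h1 : s < 1) :
    IntegrableOn (fun u : ℝ => (p * u ^ (p * s - 1)) * (1 - u ^ p) ^ (-s)) (Ioo 0 1) ∧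
      ∫ u in Ioo (0 : ℝ) 1, (p * u ^ (p * s - 1)) * (1 - u ^ p) ^ (-s)
        = Real.pi / Real.sin (Real.pi * s) := by
  have hp0 : p ≠ 0 := by omega
  have himg : (fun u : ℝ => u ^ p) '' Ioo 0 1 = Ioo 0 1 := by
    ext y
    constructor
    · rintro ⟨u, hu, rfl⟩
      exact ⟨pow_pos hu.1 _, pow_lt_one₀ hu.1.le hu.2 hp0⟩
    · intro hy
      refine ⟨y ^ ((p : ℝ)⁻¹), ⟨Real.rpow_pos_of_pos hy.1 _,
        Real.rpow_lt_one hy.1.le hy.2 (by positivity)⟩, Real.rpow_inv_natCast_pow hy.1.le hp0⟩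
  have hinj : InjOn (fun u : ℝ => u ^ p) (Ioo 0 1) := fun a ha b hb h =>
    (pow_left_inj₀ ha.1.le hb.1.le hp0).1 h
  have hd : ∀ u ∈ Ioo (0 : ℝ) 1,
      HasDerivWithinAt (fun u : ℝ => u ^ p) (p * u ^ (p - 1)) (Ioo 0 1) u :=
    fun u _ => (hasDerivAt_pow p u).hasDerivWithinAt
  have hcongr : ∀ u ∈ Ioo (0 : ℝ) 1,
      |(p : ℝ) * u ^ (p - 1)| • ((u ^ p) ^ (s - 1) * (1 - u ^ p) ^ (-s))
        = (p * u ^ (p * s - 1)) * (1 - u ^ p) ^ (-s) := by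
    intro u hu
    have hu0 := hu.1
    rw [abs_of_pos (by positivity), smul_eq_mul, ← mul_assoc]
    congr 1
    rw [mul_assoc, ← Real.rpow_natCast u p, ← Real.rpow_natCast u (p - 1), ← Real.rpow_mul hu.1.le,
      ← Real.rpow_add hu.1, Nat.cast_sub hp]
    congr 2
    push_cast
    ring
  obtain ⟨hi, hv⟩ := integral_beta_reflection h0 h1
  constructor
  · have := (integrableOn_image_iff_integrableOn_abs_deriv_smul measurableSet_Ioo hd hinj
      (fun x : ℝ => x ^ (s - 1) * (1 - x) ^ (-s))).1 (by rw [himg]; exact hi)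
    exact (integrableOn_congr_fun hcongr measurableSet_Ioo).1 this
  · rw [← hv]
    have := integral_image_eq_integral_abs_deriv_smul measurableSet_Ioo hd hinj
      (fun x : ℝ => x ^ (s - 1) * (1 - x) ^ (-s))
    rw [himg] at this
    rw [this]
    exact (setIntegral_congr_fun measurableSet_Ioo hcongr).symm

/-- Two substitutions reduce this to the beta integral with `s = 1 - 1/m`: `y = 1/u - 1` carries the
unit interval to the half line, and `y = t^m` removes the fractional power. -/
theorem integral_inv_one_add_rpow {m : ℝ} (hm : 1 < m) :
    IntegrableOn (fun t : ℝ => m / (1 + t ^ m)) (Ioi 0) ∧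
      ∫ t in Ioi (0 : ℝ), m / (1 + t ^ m) = Real.pi / Real.sin (Real.pi / m) := by
  have hm0 : 0 < m := by linarith
  have s0 : 0 < m⁻¹ := by positivity
  have s1 : m⁻¹ < 1 := inv_lt_one_of_one_lt₀ hm
  have himg : (fun u : ℝ => u⁻¹ - 1) '' Ioo 0 1 = Ioi 0 := by
    ext y
    constructor
    · rintro ⟨u, hu, rfl⟩
      have := (one_lt_inv₀ hu.1).2 hu.2
      simp only [mem_Ioi]; linarith
    · intro hy
      have hy' : (0 : ℝ) < y := hy
      refine ⟨(y + 1)⁻¹, ⟨by positivity, inv_lt_one_of_one_lt₀ (by linarith)⟩, by simp⟩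
  have hinj : InjOn (fun u : ℝ => u⁻¹ - 1) (Ioo 0 1) := fun a _ b _ h => by
    simpa using h
  have hd : ∀ u ∈ Ioo (0 : ℝ) 1,
      HasDerivWithinAt (fun u : ℝ => u⁻¹ - 1) (-(u ^ 2)⁻¹) (Ioo 0 1) u :=
    fun u hu => ((hasDerivAt_inv hu.1.ne').sub_const 1).hasDerivWithinAt
  set g : ℝ → ℝ := fun y => y ^ (m⁻¹ - 1) / (1 + y) with hg
  have hcongr : ∀ u ∈ Ioo (0 : ℝ) 1,
      |-(u ^ 2)⁻¹| • g (u⁻¹ - 1) = u ^ ((1 - m⁻¹) - 1) * (1 - u) ^ (-(1 - m⁻¹)) := by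
    intro u hu
    have hu0 := hu.1
    have h1u : 0 < 1 - u := by linarith [hu.2]
    have e : u⁻¹ - 1 = (1 - u) * u⁻¹ := by field_simp
    rw [abs_neg, abs_of_pos (by positivity), smul_eq_mul, hg]
    simp only
    rw [add_sub_cancel, e, Real.mul_rpow h1u.le (by positivity), Real.inv_rpow hu0.le,
      ← Real.rpow_neg hu0.le, neg_sub, div_inv_eq_mul, neg_sub]
    have : u ^ (1 - m⁻¹ - 1) = u ^ (1 - m⁻¹) / u := by
      rw [Real.rpow_sub hu0 (1 - m⁻¹) 1, Real.rpow_one]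
    rw [this]
    field_simp
  obtain ⟨hi, hv⟩ := integral_beta_reflection (s := 1 - m⁻¹) (by linarith) (by linarith)
  have gi : IntegrableOn g (Ioi 0) := by
    rw [← himg]
    refine (integrableOn_image_iff_integrableOn_abs_deriv_smul measurableSet_Ioo hd hinj g).2 ?_
    exact (integrableOn_congr_fun hcongr measurableSet_Ioo).2 hi
  have gv : ∫ y in Ioi (0 : ℝ), g y = Real.pi / Real.sin (Real.pi / m) := by
    rw [← himg, integral_image_eq_integral_abs_deriv_smul measurableSet_Ioo hd hinj g,
      setIntegral_congr_fun measurableSet_Ioo hcongr, hv]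
    congr 1
    rw [show Real.pi * (1 - m⁻¹) = Real.pi - Real.pi / m by field_simp, Real.sin_pi_sub]
  have hc2 : ∀ t ∈ Ioi (0 : ℝ), (|m| * t ^ (m - 1)) • g (t ^ m) = m / (1 + t ^ m) := by
    intro t ht
    have ht0 : (0 : ℝ) < t := ht
    rw [abs_of_pos hm0, smul_eq_mul, hg]
    simp only
    rw [← Real.rpow_mul ht0.le, ← mul_div_assoc, mul_assoc, ← Real.rpow_add ht0]
    have : m - 1 + m * (m⁻¹ - 1) = 0 := by field_simp; ring
    rw [this, Real.rpow_zero, mul_one]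
  constructor
  · exact (integrableOn_congr_fun hc2 measurableSet_Ioi).1
      ((integrableOn_Ioi_comp_rpow_iff g hm0.ne').2 gi)
  · rw [← gv, ← integral_comp_rpow_Ioi g hm0.ne']
    exact (setIntegral_congr_fun measurableSet_Ioi hc2).symm

theorem integrableOn_log_one_add_rpow_neg {m : ℝ} (hm : 1 < m) :
    IntegrableOn (fun t : ℝ => Real.log (1 + t ^ (-m))) (Ioi 0) := by
  have hmeas : Measurable (fun t : ℝ => Real.log (1 + t ^ (-m))) := by fun_prop
  rw [← Ioc_union_Ioi_eq_Ioi zero_le_one]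
  refine IntegrableOn.union ?_ ?_
  · have hl : IntegrableOn (fun t : ℝ => Real.log 2 - m * Real.log t) (Ioc 0 1) := by
      rw [← intervalIntegrable_iff_integrableOn_Ioc_of_le zero_le_one]
      exact intervalIntegrable_const.sub (intervalIntegral.intervalIntegrable_log'.const_mul m)
    refine Integrable.mono' hl hmeas.aestronglyMeasurable ?_
    filter_upwards [ae_restrict_mem measurableSet_Ioc] with t ht
    have h1 : 1 ≤ t ^ (-m) := Real.one_le_rpow_of_pos_of_le_one_of_nonpos ht.1 ht.2 (by linarith)
    rw [Real.norm_of_nonneg (Real.log_nonneg (by linarith))]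
    calc Real.log (1 + t ^ (-m)) ≤ Real.log (2 * t ^ (-m)) :=
          Real.log_le_log (by linarith) (by linarith)
      _ = Real.log 2 - m * Real.log t := by
          rw [Real.log_mul two_ne_zero (by linarith), Real.log_rpow ht.1]; ring
  · refine Integrable.mono' (integrableOn_Ioi_rpow_of_lt (a := -m) (by linarith) zero_lt_one)
      hmeas.aestronglyMeasurable ?_
    filter_upwards [ae_restrict_mem measurableSet_Ioi] with t ht
    have ht0 : (0 : ℝ) < t := lt_trans zero_lt_one ht
    have h1 : 0 < t ^ (-m) := Real.rpow_pos_of_pos ht0 _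
    rw [Real.norm_of_nonneg (Real.log_nonneg (by linarith))]
    linarith [Real.log_le_sub_one_of_pos (show 0 < 1 + t ^ (-m) by linarith)]

/-- Integration by parts. The boundary term `t * log (1 + t^(-m))` is at most `t^(1-m)` at infinity
and at most `t log 2 - m t log t` near 0, so it vanishes at both ends. -/
theorem integral_log_one_add_rpow_neg {m : ℝ} (hm : 1 < m) :
    ∫ t in Ioi (0 : ℝ), Real.log (1 + t ^ (-m)) = Real.pi / Real.sin (Real.pi / m) := by
  obtain ⟨hi, hv⟩ := integral_inv_one_add_rpow hm
  have hm0 : 0 < m := by linarith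
  have hlog := integrableOn_log_one_add_rpow_neg hm
  have hd : ∀ t ∈ Ioi (0 : ℝ), HasDerivAt (fun t : ℝ => t * Real.log (1 + t ^ (-m)))
      (Real.log (1 + t ^ (-m)) - m / (1 + t ^ m)) t := by
    intro t ht
    have ht0 : (0 : ℝ) < t := ht
    have hp : 0 < t ^ m := Real.rpow_pos_of_pos ht0 _
    have hne : 1 + t ^ (-m) ≠ 0 := by have := Real.rpow_pos_of_pos ht0 (-m); linarith
    convert! (hasDerivAt_id t).mul (((Real.hasDerivAt_rpow_const (x := t) (p := -m)
      (Or.inl ht0.ne')).const_add 1).log hne) using 1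
    rw [Real.rpow_sub ht0, Real.rpow_neg ht0.le, Real.rpow_one]
    simp only [id]
    field_simp
    ring
  have hbd : ∀ t : ℝ, 0 < t → t * Real.log (1 + t ^ (-m)) ≤ t ^ (1 - m) := by
    intro t ht0
    have h1 : 0 < t ^ (-m) := Real.rpow_pos_of_pos ht0 _
    have := Real.log_le_sub_one_of_pos (show 0 < 1 + t ^ (-m) by linarith)
    rw [show 1 - m = 1 + -m by ring, Real.rpow_add ht0, Real.rpow_one]
    gcongr
    linarith
  have hnn : ∀ t : ℝ, 0 < t → 0 ≤ t * Real.log (1 + t ^ (-m)) := fun t ht0 =>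
    mul_nonneg ht0.le (Real.log_nonneg (by linarith [Real.rpow_pos_of_pos ht0 (-m)]))
  have hinf : Tendsto (fun t : ℝ => t * Real.log (1 + t ^ (-m))) atTop (𝓝 0) := by
    have h := tendsto_rpow_neg_atTop (y := m - 1) (by linarith)
    refine tendsto_of_tendsto_of_tendsto_of_le_of_le' tendsto_const_nhds h ?_ ?_
    · filter_upwards [eventually_gt_atTop 0] with t ht using hnn t ht
    · filter_upwards [eventually_gt_atTop 0] with t ht
      simpa using hbd t ht
  have hzero : Tendsto (fun t : ℝ => t * Real.log (1 + t ^ (-m))) (𝓝[>] 0) (𝓝 0) := by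
    have h1 : Tendsto (fun t : ℝ => t * Real.log 2 - m * (t * Real.log t)) (𝓝[>] 0) (𝓝 0) := by
      have hc : Continuous fun t : ℝ => t * Real.log 2 - m * (t * Real.log t) :=
        (continuous_id.mul continuous_const).sub (continuous_const.mul Real.continuous_mul_log)
      have := hc.tendsto 0
      simp only [zero_mul, mul_zero, sub_zero] at this
      exact this.mono_left nhdsWithin_le_nhds
    refine tendsto_of_tendsto_of_tendsto_of_le_of_le' tendsto_const_nhds h1 ?_ ?_
    · filter_upwards [self_mem_nhdsWithin] with t ht using hnn t ht
    · filter_upwards [Ioo_mem_nhdsGT (zero_lt_one (α := ℝ))] with t ht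
      have h1 : 1 ≤ t ^ (-m) :=
        Real.one_le_rpow_of_pos_of_le_one_of_nonpos ht.1 ht.2.le (by linarith)
      have h2 : Real.log (1 + t ^ (-m)) ≤ Real.log 2 - m * Real.log t := by
        calc Real.log (1 + t ^ (-m)) ≤ Real.log (2 * t ^ (-m)) :=
              Real.log_le_log (by linarith) (by linarith)
          _ = Real.log 2 - m * Real.log t := by
              rw [Real.log_mul two_ne_zero (by linarith), Real.log_rpow ht.1]; ring
      nlinarith [ht.1]
  have h3 : ∫ t in Ioi (0 : ℝ), (Real.log (1 + t ^ (-m)) - m / (1 + t ^ m)) = 0 - 0 := by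
    have := integral_Ioi_of_hasDerivAt_of_tendsto (a := (0 : ℝ)) (m := 0)
      (f := fun t : ℝ => t * Real.log (1 + t ^ (-m))) ?_ hd (hlog.sub hi) hinf
    · simpa using this
    -- At `t = 0` the factor `t` makes the value 0 whatever the logarithm is there, so continuity
    -- from the right reduces to the limit `hzero`.
    · rw [ContinuousWithinAt, zero_mul, ← Ioi_insert, nhdsWithin_insert, tendsto_sup]
      refine ⟨?_, hzero⟩
      simpa using tendsto_pure_nhds (fun t : ℝ => t * Real.log (1 + t ^ (-m))) 0
  rw [integral_sub hlog hi, hv] at h3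
  linarith

end

/-! ### Bounds for Valent's integral; comparison of logarithmic sums with integrals. -/

section

open MeasureTheory Set Topology

theorem valentIntegrand_eq {p : ℕ} {u : ℝ} (hu : u ∈ Ioo (0 : ℝ) 1) :
    valentIntegrand p u = (1 - u ^ p) ^ (-(2 / (p : ℝ))) := by
  rw [valentIntegrand, Real.rpow_neg, one_div]
  linarith [pow_le_one₀ (n := p) hu.1.le hu.2.le]

theorem valentIntegrand_mono {p : ℕ} (hp : p ≠ 0) {u v : ℝ} (hu : 0 ≤ u) (huv : u ≤ v)
    (hv : v < 1) : valentIntegrand p u ≤ valentIntegrand p v := by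
  have h1 : u ^ p ≤ v ^ p := pow_le_pow_left₀ hu huv p
  have h2 : v ^ p < 1 := pow_lt_one₀ (hu.trans huv) hv hp
  unfold valentIntegrand
  have : 0 < (1 - v ^ p) ^ (2 / (p : ℝ)) := Real.rpow_pos_of_pos (by linarith) _
  exact one_div_le_one_div_of_le this (Real.rpow_le_rpow (by linarith) (by linarith) (by positivity))

theorem sin_pi_div_pos {p : ℕ} (hp : 3 ≤ p) : 0 < Real.sin (Real.pi / p) := by
  have hp3 : (3 : ℝ) ≤ p := by exact_mod_cast hp
  exact Real.sin_pos_of_pos_of_lt_pi (by positivity) (div_lt_self Real.pi_pos (by linarith))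

theorem lowerBound_eq_integral {p : ℕ} (hp : 3 ≤ p) :
    IntegrableOn (fun u : ℝ => (1 - u ^ p) ^ (-(1 / (p : ℝ)))) (Ioo 0 1) ∧
      ∫ u in Ioo (0 : ℝ) 1, (1 - u ^ p) ^ (-(1 / (p : ℝ))) = lowerBound p := by
  have hp3 : (3 : ℝ) ≤ p := by exact_mod_cast hp
  have hp0 : (0 : ℝ) < p := by linarith
  obtain ⟨hi, hv⟩ := integral_one_sub_pow (p := p) (by omega) (s := 1 / p) (by positivity)
    ((div_lt_one hp0).2 (by linarith))
  have e : ∀ u : ℝ, (p * u ^ ((p : ℝ) * (1 / p) - 1)) * (1 - u ^ p) ^ (-(1 / (p : ℝ)))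
      = p * (1 - u ^ p) ^ (-(1 / (p : ℝ))) := by
    intro u
    rw [mul_one_div_cancel hp0.ne', sub_self, Real.rpow_zero, mul_one]
  simp only [e] at hi hv
  refine ⟨(integrable_const_mul_iff (IsUnit.mk0 _ hp0.ne') _).1 hi, ?_⟩
  rw [integral_const_mul] at hv
  rw [lowerBound, eq_div_iff_mul_eq, mul_comm, mul_comm (p : ℝ), mul_assoc, hv, mul_one_div]
  · have := sin_pi_div_pos hp
    field_simp
  · have := sin_pi_div_pos hp
    positivity

theorem cos_pi_div_pos {p : ℕ} (hp : 3 ≤ p) : 0 < Real.cos (Real.pi / p) := by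
  have hp3 : (3 : ℝ) ≤ p := by exact_mod_cast hp
  have : 0 < Real.pi / p := by positivity
  exact Real.cos_pos_of_mem_Ioo ⟨by linarith [Real.pi_pos],
    div_lt_div_of_pos_left Real.pi_pos two_pos (by linarith)⟩

/-- The double angle formula puts the upper bound in the form in which the exponent `m = p / 2`
produces it. -/
theorem upperBound_eq {p : ℕ} :
    upperBound p = 2 * (Real.pi / Real.sin (Real.pi / (p / 2))) / p := by
  rw [upperBound, show Real.pi / ((p : ℝ) / 2) = 2 * (Real.pi / p) by
    rw [div_div_eq_mul_div]; ring, Real.sin_two_mul]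
  rw [show 2 * Real.sin (Real.pi / p) * Real.cos (Real.pi / p)
    = 2 * (Real.sin (Real.pi / p) * Real.cos (Real.pi / p)) by ring, ← mul_div_assoc,
    mul_div_mul_left _ _ two_ne_zero, div_div]
  congr 1
  ring

theorem upperBound_eq_integral {p : ℕ} (hp : 3 ≤ p) :
    IntegrableOn (fun u : ℝ => 2 * u * valentIntegrand p u) (Ioo 0 1) ∧
      ∫ u in Ioo (0 : ℝ) 1, 2 * u * valentIntegrand p u = upperBound p := by
  have hp3 : (3 : ℝ) ≤ p := by exact_mod_cast hp
  have hp0 : (0 : ℝ) < p := by linarith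
  obtain ⟨hi, hv⟩ := integral_one_sub_pow (p := p) (by omega) (s := 2 / p) (by positivity)
    ((div_lt_one hp0).2 (by linarith))
  have e : ∀ u ∈ Ioo (0 : ℝ) 1,
      (p * u ^ ((p : ℝ) * (2 / p) - 1)) * (1 - u ^ p) ^ (-(2 / (p : ℝ)))
      = (p / 2) * (2 * u * valentIntegrand p u) := by
    intro u hu
    rw [valentIntegrand_eq hu, mul_div_cancel₀ _ hp0.ne',
      show (2 : ℝ) - 1 = 1 by norm_num, Real.rpow_one]
    ring
  rw [setIntegral_congr_fun measurableSet_Ioo e, integral_const_mul] at hv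
  have hi' := (integrableOn_congr_fun e measurableSet_Ioo).1 hi
  refine ⟨(integrable_const_mul_iff (IsUnit.mk0 _ (by positivity)) _).1 hi', ?_⟩
  rw [upperBound_eq, show Real.pi / ((p : ℝ) / 2) = Real.pi * (2 / p) by
    rw [div_div_eq_mul_div]; ring, ← hv]
  field_simp

/-- The integrand is increasing, so its value at `1/2` bounds it on the left half; on the right half
`2u ≥ 1` and the integrand of the upper bound dominates. -/
theorem valentIntegrand_integrableOn {p : ℕ} (hp : 3 ≤ p) :
    IntegrableOn (valentIntegrand p) (Ioo 0 1) := by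
  have hmeas : Measurable (valentIntegrand p) := by unfold valentIntegrand; fun_prop
  refine Integrable.mono' (g := fun u => valentIntegrand p (1 / 2) + 2 * u * valentIntegrand p u)
    ((integrableOn_const (by simp)).add (upperBound_eq_integral hp).1)
    hmeas.aestronglyMeasurable ?_
  have hnn : ∀ u ∈ Ioo (0 : ℝ) 1, 0 ≤ valentIntegrand p u := fun u hu => by
    rw [valentIntegrand_eq hu]
    exact Real.rpow_nonneg (by linarith [pow_le_one₀ (n := p) hu.1.le hu.2.le]) _
  filter_upwards [ae_restrict_mem measurableSet_Ioo] with u hu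
  have h0 := hnn u hu
  have h2 := hnn (1 / 2) (by norm_num)
  rw [Real.norm_of_nonneg h0]
  rcases le_total u (1 / 2) with h | h
  · have := valentIntegrand_mono (p := p) (by omega) hu.1.le h (by norm_num)
    have := mul_nonneg (mul_nonneg zero_le_two hu.1.le) h0
    linarith
  · nlinarith

theorem lowerBound_le_valentIntegral {p : ℕ} (hp : 3 ≤ p) : lowerBound p ≤ valentIntegral p := by
  have hp3 : (3 : ℝ) ≤ p := by exact_mod_cast hp
  rw [valentIntegral, intervalIntegral.integral_of_le zero_le_one, integral_Ioc_eq_integral_Ioo,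
    ← (lowerBound_eq_integral hp).2]
  refine setIntegral_mono_on (lowerBound_eq_integral hp).1 (valentIntegrand_integrableOn hp)
    measurableSet_Ioo fun u hu => ?_
  rw [valentIntegrand_eq hu]
  have h1 : u ^ p < 1 := pow_lt_one₀ hu.1.le hu.2 (by omega)
  have h2 : 0 < u ^ p := pow_pos hu.1 p
  refine Real.rpow_le_rpow_of_exponent_ge (by linarith) (by linarith) ?_
  have : (1 : ℝ) / p ≤ 2 / p := by gcongr; norm_num
  linarith

/-- Chebyshev's inequality: the integrand `f` increases while `1 - 2u` changes sign at `1/2`, so `(1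
- 2u) (f u - f (1/2)) ≤ 0`, and `1 - 2u` has integral 0. -/
theorem valentIntegral_le_upperBound {p : ℕ} (hp : 3 ≤ p) : valentIntegral p ≤ upperBound p := by
  rw [valentIntegral, intervalIntegral.integral_of_le zero_le_one, integral_Ioc_eq_integral_Ioo,
    ← (upperBound_eq_integral hp).2]
  have hi := valentIntegrand_integrableOn hp
  have hu := (upperBound_eq_integral hp).1
  set G := valentIntegrand p (1 / 2)
  have hlin : IntegrableOn (fun u : ℝ => (1 - 2 * u) * G) (Ioo 0 1) := by
    rw [← intervalIntegrable_iff_integrableOn_Ioo_of_le zero_le_one]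
    exact Continuous.intervalIntegrable (by fun_prop) _ _
  have hz : ∫ u in Ioo (0 : ℝ) 1, (1 - 2 * u) * G = 0 := by
    rw [← integral_Ioc_eq_integral_Ioo, ← intervalIntegral.integral_of_le zero_le_one,
      intervalIntegral.integral_mul_const, intervalIntegral.integral_sub
        (by simp) (Continuous.intervalIntegrable (by fun_prop) _ _),
      intervalIntegral.integral_const_mul, integral_id]
    norm_num
  have h := setIntegral_mono_on hi (hu.add hlin) measurableSet_Ioo fun u hu => by
    have : (1 - 2 * u) * valentIntegrand p u ≤ (1 - 2 * u) * G := by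
      rcases le_total u (1 / 2) with h | h
      · exact mul_le_mul_of_nonneg_left
          (valentIntegrand_mono (by omega) hu.1.le h (by norm_num)) (by linarith)
      · exact mul_le_mul_of_nonpos_left
          (valentIntegrand_mono (by omega) (by norm_num) h hu.2) (by linarith)
    show valentIntegrand p u ≤ 2 * u * valentIntegrand p u + (1 - 2 * u) * G
    linarith
  have h3 := integral_add hu hlin
  simp only [Pi.add_apply] at h
  rw [h3, hz, add_zero] at h
  exact h

theorem log_one_add_rpow_neg_nonneg (m : ℝ) {t : ℝ} (ht : 0 < t) :
    0 ≤ Real.log (1 + t ^ (-m)) :=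
  Real.log_nonneg (by linarith [Real.rpow_pos_of_pos ht (-m)])

theorem integral_log_one_add_div_rpow_neg {m y : ℝ} (hm : 1 < m) (hy : 0 < y) :
    IntegrableOn (fun t : ℝ => Real.log (1 + (t / y) ^ (-m))) (Ioi 0) ∧
      ∫ t in Ioi (0 : ℝ), Real.log (1 + (t / y) ^ (-m))
        = y * (Real.pi / Real.sin (Real.pi / m)) := by
  have hy' : 0 < y⁻¹ := inv_pos.2 hy
  simp only [div_eq_inv_mul _ y]
  constructor
  · refine (integrableOn_Ioi_comp_mul_left_iff (fun t => Real.log (1 + t ^ (-m))) 0 hy').2 ?_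
    simpa using integrableOn_log_one_add_rpow_neg hm
  · rw [integral_comp_mul_left_Ioi (fun t => Real.log (1 + t ^ (-m))) 0 hy', mul_zero,
      integral_log_one_add_rpow_neg hm, inv_inv, smul_eq_mul]

theorem antitoneOn_log_one_add_div_rpow_neg {m y : ℝ} (hm : 0 < m) (hy : 0 < y) :
    AntitoneOn (fun t : ℝ => Real.log (1 + (t / y) ^ (-m))) (Ioi 0) := by
  intro s hs t ht hst
  have hs0 : 0 < s / y := div_pos hs hy
  have ht0 : 0 < t / y := div_pos ht hy
  have h1 := Real.rpow_pos_of_pos ht0 (-m)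
  refine Real.log_le_log (by linarith) ?_
  have := Real.rpow_le_rpow_of_nonpos hs0 (by gcongr : s / y ≤ t / y) (by linarith : -m ≤ 0)
  linarith

/-- The comparison integral starts at 1, away from the singularity at 0, so the sum starts at index
2; the terms of index 0 and 1 are treated separately where this is applied. -/
theorem sum_log_one_add_le {m y : ℝ} (hm : 1 < m) (hy : 0 < y) (N : ℕ) :
    ∑ i ∈ Finset.range N, Real.log (1 + (((i : ℝ) + 2) / y) ^ (-m))
      ≤ y * (Real.pi / Real.sin (Real.pi / m)) := by
  obtain ⟨hi, hv⟩ := integral_log_one_add_div_rpow_neg hm hy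
  have hsub : Icc (1 : ℝ) (1 + N) ⊆ Ioi 0 := fun t ht => lt_of_lt_of_le zero_lt_one ht.1
  have h := AntitoneOn.sum_le_integral (x₀ := 1) (a := N)
    ((antitoneOn_log_one_add_div_rpow_neg (zero_lt_one.trans hm) hy).mono hsub)
  rw [← hv]
  refine le_trans (le_of_eq ?_) (h.trans ?_)
  · refine Finset.sum_congr rfl fun i _ => ?_
    push_cast
    ring_nf
  · rw [intervalIntegral.integral_of_le (by simp)]
    refine setIntegral_mono_set hi ?_ (LE.le.eventuallyLE
      (fun t ht => hsub ⟨ht.1.le, ht.2⟩))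
    filter_upwards [ae_restrict_mem measurableSet_Ioi] with t ht
    exact log_one_add_rpow_neg_nonneg m (div_pos ht hy)

/-- Beyond `k` the sum dominates the integral. On `(0, k]` the loss is only logarithmic in `y`:
`(t/y)^(-m) = y^m * t^(-m)` and `1 + a b ≤ a (1 + b)` for `a ≥ 1`. -/
theorem le_of_sum_log_one_add_le {m y B : ℝ} (hm : 1 < m) (hy : 1 ≤ y) {k : ℕ} (hk : 0 < k)
    (hB : ∀ N : ℕ, ∑ i ∈ Finset.range N, Real.log (1 + (((k : ℝ) + i) / y) ^ (-m)) ≤ B) :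
    y * (Real.pi / Real.sin (Real.pi / m))
      ≤ B + k * m * Real.log y + Real.pi / Real.sin (Real.pi / m) := by
  have hy0 : 0 < y := by linarith
  have hk0 : (0 : ℝ) < k := by exact_mod_cast hk
  obtain ⟨hi, hv⟩ := integral_log_one_add_div_rpow_neg hm hy0
  have hnn : 0 ≤ᵐ[volume.restrict (Ioi (0 : ℝ))] fun t : ℝ => Real.log (1 + (t / y) ^ (-m)) := by
    filter_upwards [ae_restrict_mem measurableSet_Ioi] with t ht
    exact log_one_add_rpow_neg_nonneg m (div_pos ht hy0)
  rw [← hv, ← Ioc_union_Ioi_eq_Ioi hk0.le, setIntegral_union (Ioc_disjoint_Ioi le_rfl)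
    measurableSet_Ioi (hi.mono_set Ioc_subset_Ioi_self) (hi.mono_set (Ioi_subset_Ioi hk0.le))]
  have h1 : ∫ t in Ioi (k : ℝ), Real.log (1 + (t / y) ^ (-m)) ≤ B := by
    have ht : Tendsto (fun N : ℕ => ∫ t in (k : ℝ)..(k + N : ℝ), Real.log (1 + (t / y) ^ (-m)))
        atTop (𝓝 (∫ t in Ioi (k : ℝ), Real.log (1 + (t / y) ^ (-m)))) :=
      intervalIntegral_tendsto_integral_Ioi _ (hi.mono_set (Ioi_subset_Ioi hk0.le))
        (tendsto_atTop_add_const_left _ _ tendsto_natCast_atTop_atTop)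
    refine le_of_tendsto' ht fun N => ?_
    refine (AntitoneOn.integral_le_sum ?_).trans (hB N)
    exact (antitoneOn_log_one_add_div_rpow_neg (by linarith) hy0).mono
      fun t ht => lt_of_lt_of_le hk0 ht.1
  have h2 : ∫ t in Ioc 0 (k : ℝ), Real.log (1 + (t / y) ^ (-m))
      ≤ k * m * Real.log y + Real.pi / Real.sin (Real.pi / m) := by
    have hlog := integrableOn_log_one_add_rpow_neg hm
    have hlog' := hlog.mono_set (Ioc_subset_Ioi_self : Ioc (0 : ℝ) k ⊆ Ioi 0)
    have hc : IntegrableOn (fun _ : ℝ => m * Real.log y) (Ioc 0 (k : ℝ)) :=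
      integrableOn_const (by simp)
    calc ∫ t in Ioc 0 (k : ℝ), Real.log (1 + (t / y) ^ (-m))
        ≤ ∫ t in Ioc 0 (k : ℝ), (m * Real.log y + Real.log (1 + t ^ (-m))) := by
          refine setIntegral_mono_on (hi.mono_set Ioc_subset_Ioi_self) (hc.add hlog')
            measurableSet_Ioc fun t ht => ?_
          have ht0 := ht.1
          have h3 := Real.rpow_pos_of_pos ht0 (-m)
          have h4 : 1 ≤ y ^ m := Real.one_le_rpow hy (by linarith)
          have h5 : (t / y) ^ (-m) = y ^ m * t ^ (-m) := by
            rw [Real.div_rpow ht0.le hy0.le, Real.rpow_neg hy0.le, div_inv_eq_mul, mul_comm]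
          have h6 : m * Real.log y = Real.log (y ^ m) := (Real.log_rpow hy0 m).symm
          rw [h5, h6, ← Real.log_mul (by positivity) (by positivity)]
          refine Real.log_le_log (by positivity) ?_
          nlinarith
      _ = k * m * Real.log y + ∫ t in Ioc 0 (k : ℝ), Real.log (1 + t ^ (-m)) := by
          rw [integral_add hc hlog', setIntegral_const]
          simp [mul_assoc]
      _ ≤ _ := by
          rw [← integral_log_one_add_rpow_neg hm]
          refine add_le_add le_rfl ?_
          refine setIntegral_mono_set hlog ?_ (LE.le.eventuallyLE
            (Ioc_subset_Ioi_self : Ioc (0 : ℝ) k ⊆ Ioi 0))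
          filter_upwards [ae_restrict_mem measurableSet_Ioi] with t ht
          exact log_one_add_rpow_neg_nonneg m ht
  linarith

end

/-! ### The discrete string equation: positivity, majorants and growth. -/

section

open Topology

/-- The discrete string equation with masses `w` and lengths `q` at spectral parameter `-x`:
`v' = v + x w u`, `u' = u + q v'`. -/
def sol {K : Type*} [CommSemiring K] (w q : ℕ → K) (x u v : K) : ℕ → K × K
  | 0 => (u, v)
  | n + 1 => ((sol w q x u v n).1 + q n * ((sol w q x u v n).2 + x * w n * (sol w q x u v n).1),
      (sol w q x u v n).2 + x * w n * (sol w q x u v n).1)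

section Semiring

variable {K : Type*} [CommSemiring K] (w q : ℕ → K) (x u v : K)

@[simp] theorem sol_zero : sol w q x u v 0 = (u, v) := rfl

theorem sol_succ_snd (n : ℕ) : (sol w q x u v (n + 1)).2 =
    (sol w q x u v n).2 + x * w n * (sol w q x u v n).1 := rfl

theorem sol_succ_fst (n : ℕ) : (sol w q x u v (n + 1)).1 =
    (sol w q x u v n).1 + q n * (sol w q x u v (n + 1)).2 := rfl

theorem sol_snd_eq_sum (n : ℕ) : (sol w q x u v n).2 =
    v + x * ∑ i ∈ Finset.range n, w i * (sol w q x u v i).1 := by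
  induction n with
  | zero => simp
  | succ n ih => rw [sol_succ_snd, ih, Finset.sum_range_succ]; ring

theorem sol_fst_eq_sum (n : ℕ) : (sol w q x u v n).1 =
    u + ∑ i ∈ Finset.range n, q i * (sol w q x u v (i + 1)).2 := by
  induction n with
  | zero => simp
  | succ n ih => rw [sol_succ_fst, ih, Finset.sum_range_succ]; ring

end Semiring

theorem sol_ofReal (w q : ℕ → ℝ) (x u v : ℝ) (n : ℕ) :
    sol (fun k => (w k : ℂ)) (fun k => (q k : ℂ)) x u v n =
      (((sol w q x u v n).1 : ℂ), ((sol w q x u v n).2 : ℂ)) := by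
  induction n with
  | zero => rfl
  | succ n ih => ext <;> simp [sol, ih]

/-- Positive masses and lengths with finite total mass and finite total length. -/
structure RegularString (w q : ℕ → ℝ) : Prop where
  w_pos : ∀ n, 0 < w n
  q_pos : ∀ n, 0 < q n
  w_summable : Summable w
  q_summable : Summable q

section Real

variable {w q : ℕ → ℝ} {x u v : ℝ}

theorem sol_nonneg (h : RegularString w q) (hx : 0 ≤ x) (hu : 0 ≤ u) (hv : 0 ≤ v) (n : ℕ) :
    0 ≤ (sol w q x u v n).1 ∧ 0 ≤ (sol w q x u v n).2 := by
  induction n with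
  | zero => exact ⟨hu, hv⟩
  | succ n ih =>
    have hw := (h.w_pos n).le
    have hq := (h.q_pos n).le
    obtain ⟨h1, h2⟩ := ih
    rw [sol_succ_fst, sol_succ_snd]
    constructor <;> positivity

/-- The recursion is linear with nonnegative coefficients, hence monotone. Starting at index `k`
allows initial vectors that become comparable only after some steps. -/
theorem sol_le_of_le (h : RegularString w q) (hx : 0 ≤ x) {c u' v' : ℝ} {k : ℕ}
    (h1 : (sol w q x u v k).1 ≤ c * (sol w q x u' v' k).1)
    (h2 : (sol w q x u v k).2 ≤ c * (sol w q x u' v' k).2) {n : ℕ} (hn : k ≤ n) :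
    (sol w q x u v n).1 ≤ c * (sol w q x u' v' n).1 ∧
      (sol w q x u v n).2 ≤ c * (sol w q x u' v' n).2 := by
  induction n, hn using Nat.le_induction with
  | base => exact ⟨h1, h2⟩
  | succ n _ ih =>
    have hw := mul_nonneg hx (h.w_pos n).le
    have hq := (h.q_pos n).le
    have e2 : (sol w q x u v (n + 1)).2 ≤ c * (sol w q x u' v' (n + 1)).2 := by
      rw [sol_succ_snd, sol_succ_snd]
      nlinarith [mul_le_mul_of_nonneg_left ih.1 hw, ih.2]
    refine ⟨?_, e2⟩
    rw [sol_succ_fst, sol_succ_fst]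
    nlinarith [mul_le_mul_of_nonneg_left e2 hq, ih.1]

theorem norm_sol_le (h : RegularString w q) {z u v : ℂ} {r u' v' : ℝ} (hz : ‖z‖ ≤ r)
    (hu : ‖u‖ ≤ u') (hv : ‖v‖ ≤ v') (n : ℕ) :
    ‖(sol (fun k => (w k : ℂ)) (fun k => (q k : ℂ)) z u v n).1‖ ≤ (sol w q r u' v' n).1 ∧
      ‖(sol (fun k => (w k : ℂ)) (fun k => (q k : ℂ)) z u v n).2‖ ≤ (sol w q r u' v' n).2 := by
  induction n with
  | zero => exact ⟨hu, hv⟩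
  | succ n ih =>
    have hw := (h.w_pos n).le
    have hq := (h.q_pos n).le
    have hr : 0 ≤ r := (norm_nonneg z).trans hz
    have e2 : ‖(sol (fun k => (w k : ℂ)) (fun k => (q k : ℂ)) z u v (n + 1)).2‖ ≤
        (sol w q r u' v' (n + 1)).2 := by
      rw [sol_succ_snd, sol_succ_snd]
      refine (norm_add_le _ _).trans (add_le_add ih.2 ?_)
      rw [norm_mul, norm_mul, Complex.norm_of_nonneg hw]
      gcongr
      exact ih.1
    refine ⟨?_, e2⟩
    rw [sol_succ_fst, sol_succ_fst]
    refine (norm_add_le _ _).trans (add_le_add ih.1 ?_)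
    rw [norm_mul, Complex.norm_of_nonneg hq]
    gcongr

theorem sol_add_le_mul_exp (h : RegularString w q) (hx : 0 ≤ x) (hu : 0 ≤ u) (hv : 0 ≤ v)
    (N n : ℕ) : (sol w q x u v (N + n)).1 + (sol w q x u v (N + n)).2 ≤
      ((sol w q x u v N).1 + (sol w q x u v N).2) *
        Real.exp (∑ i ∈ Finset.range n, (x * w (N + i) + q (N + i))) := by
  induction n with
  | zero => simp
  | succ n ih =>
    have hw := mul_nonneg hx (h.w_pos (N + n)).le
    have hq := (h.q_pos (N + n)).le
    obtain ⟨h1, h2⟩ := sol_nonneg h hx hu hv (N + n)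
    rw [← add_assoc, sol_succ_fst, sol_succ_snd, Finset.sum_range_succ, Real.exp_add, ← mul_assoc]
    refine le_trans ?_ (mul_le_mul_of_nonneg_right ih (Real.exp_pos _).le)
    rw [Real.exp_add]
    have e1 := Real.add_one_le_exp (x * w (N + n))
    have e2 := Real.add_one_le_exp (q (N + n))
    have e3 : (1 + x * w (N + n)) * (1 + q (N + n)) ≤
        Real.exp (x * w (N + n)) * Real.exp (q (N + n)) := by
      apply mul_le_mul <;> linarith [Real.exp_pos (x * w (N + n))]
    refine le_trans ?_ (mul_le_mul_of_nonneg_left e3 (add_nonneg h1 h2))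
    have := mul_nonneg hq h1
    have := mul_nonneg (mul_nonneg hw hq) h2
    have := mul_nonneg hw h2
    nlinarith

/-- Each step multiplies `u + v` by at most `(1 + x w) (1 + q)`. The tail of the masses is kept
because it has to compensate the large factor `x`; for the lengths the total is enough. -/
theorem sol_add_le_mul_exp_tsum (h : RegularString w q) (hx : 0 ≤ x) (hu : 0 ≤ u) (hv : 0 ≤ v)
    (N n : ℕ) : (sol w q x u v (N + n)).1 + (sol w q x u v (N + n)).2 ≤
      ((sol w q x u v N).1 + (sol w q x u v N).2) *
        Real.exp (x * (∑' i, w (N + i)) + ∑' i, q i) := by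
  obtain ⟨h1, h2⟩ := sol_nonneg h hx hu hv N
  refine (sol_add_le_mul_exp h hx hu hv N n).trans
    (mul_le_mul_of_nonneg_left (Real.exp_le_exp.2 ?_) (add_nonneg h1 h2))
  have hws : Summable fun i => w (N + i) := by
    simpa only [add_comm] using (summable_nat_add_iff N).2 h.w_summable
  rw [Finset.sum_add_distrib, ← Finset.mul_sum]
  refine add_le_add (mul_le_mul_of_nonneg_left
    (hws.sum_le_tsum _ fun i _ => (h.w_pos _).le) hx) ?_
  have := h.q_summable.sum_le_tsum ((Finset.range n).map (addLeftEmbedding N))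
    fun i _ => (h.q_pos _).le
  simpa using this

/-- The solutions are bounded in `n`. -/
theorem sol_fst_le (h : RegularString w q) (hx : 0 ≤ x) (hu : 0 ≤ u) (hv : 0 ≤ v) (n : ℕ) :
    (sol w q x u v n).1 ≤ (u + v) * Real.exp (x * (∑' i, w i) + ∑' i, q i) := by
  have := sol_add_le_mul_exp_tsum h hx hu hv 0 n
  simp only [zero_add, sol_zero] at this
  linarith [(sol_nonneg h hx hu hv n).2]

theorem summable_mul_sol (h : RegularString w q) (hx : 0 ≤ x) (hu : 0 ≤ u) (hv : 0 ≤ v) :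
    Summable fun k => w k * (sol w q x u v k).1 := by
  refine Summable.of_nonneg_of_le
    (fun k => mul_nonneg (h.w_pos k).le (sol_nonneg h hx hu hv k).1)
    (fun k => mul_le_mul_of_nonneg_left (sol_fst_le h hx hu hv k) (h.w_pos k).le)
    (h.w_summable.mul_right _)

/-- The flux at infinity of the solution that starts at `(1, 0)`. -/
def flux (w q : ℕ → ℝ) (x : ℝ) : ℝ := x * ∑' k, w k * (sol w q x 1 0 k).1

theorem sol_snd_le_flux (h : RegularString w q) (hx : 0 ≤ x) (n : ℕ) :
    (sol w q x 1 0 n).2 ≤ flux w q x := by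
  rw [sol_snd_eq_sum, zero_add, flux]
  exact mul_le_mul_of_nonneg_left ((summable_mul_sol h hx zero_le_one le_rfl).sum_le_tsum _
    fun i _ => mul_nonneg (h.w_pos i).le (sol_nonneg h hx zero_le_one le_rfl i).1) hx

theorem flux_le (h : RegularString w q) (hx : 0 ≤ x) {B : ℝ} {N : ℕ}
    (hB : ∀ n, (sol w q x 1 0 (N + n)).2 ≤ B) : flux w q x ≤ B := by
  have ht := ((summable_mul_sol h hx zero_le_one le_rfl).hasSum.tendsto_sum_nat.const_mul x)
  refine le_of_tendsto ht ?_
  filter_upwards [eventually_ge_atTop N] with n hn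
  obtain ⟨k, rfl⟩ := Nat.exists_eq_add_of_le hn
  have := hB k
  rwa [sol_snd_eq_sum, zero_add] at this

theorem mul_le_flux (h : RegularString w q) (hx : 0 ≤ x) : x * w 0 ≤ flux w q x := by
  have := sol_snd_le_flux h hx 1
  rw [sol_succ_snd] at this
  simpa using this

/-- Dropping the old `v` from a step leaves `u' ≥ (1 + x w q) u`. -/
theorem prod_le_sol_fst (h : RegularString w q) (hx : 0 ≤ x) (n : ℕ) :
    ∏ i ∈ Finset.range n, (1 + x * (w i * q i)) ≤ (sol w q x 1 0 n).1 := by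
  induction n with
  | zero => simp
  | succ n ih =>
    have hw := (h.w_pos n).le
    have hq := (h.q_pos n).le
    obtain ⟨h1, h2⟩ := sol_nonneg h hx zero_le_one (le_refl (0 : ℝ)) n
    rw [Finset.prod_range_succ, sol_succ_fst, sol_succ_snd]
    have h3 : 0 ≤ 1 + x * (w n * q n) := by positivity
    have := mul_le_mul_of_nonneg_right ih h3
    have := mul_nonneg hq h2
    nlinarith

/-- Transfers the product bound from displacement to flux: each increment of `u` is `q i` times a
value of `v`, and these never exceed the flux. -/
theorem prod_le_one_add_flux (h : RegularString w q) (hx : 0 ≤ x) (n : ℕ) :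
    ∏ i ∈ Finset.range n, (1 + x * (w i * q i)) ≤ 1 + (∑' i, q i) * flux w q x := by
  refine (prod_le_sol_fst h hx n).trans ?_
  rw [sol_fst_eq_sum]
  have h0 : 0 ≤ flux w q x := le_trans (mul_nonneg hx (h.w_pos 0).le) (mul_le_flux h hx)
  gcongr
  calc ∑ i ∈ Finset.range n, q i * (sol w q x 1 0 (i + 1)).2
      ≤ ∑ i ∈ Finset.range n, q i * flux w q x := Finset.sum_le_sum fun i _ =>
        mul_le_mul_of_nonneg_left (sol_snd_le_flux h hx _) (h.q_pos i).le
    _ = (∑ i ∈ Finset.range n, q i) * flux w q x := by rw [Finset.sum_mul]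
    _ ≤ _ := by
      gcongr
      exact h.q_summable.sum_le_tsum _ fun i _ => (h.q_pos i).le

/-- Growth of the weighted energy `u + (t / s) v` for `x = s ^ 2` and `q = t ^ 2 w`. -/
theorem energy_le (h : RegularString w q) {s K : ℝ} (hs : 0 < s) (hK : 0 ≤ K) {t : ℕ → ℝ}
    (ht : ∀ n, 0 < t n) (hq : ∀ n, q n = t n ^ 2 * w n)
    (hup : ∀ n : ℕ, t (n + 1) ≤ Real.exp (K / (n + 1)) * t n) (n : ℕ) :
    (sol w q (s ^ 2) 1 0 n).1 + t n / s * (sol w q (s ^ 2) 1 0 n).2 ≤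
      ∏ i ∈ Finset.range n, (Real.exp (K / (i + 1)) * (1 + s * (t i * w i)) ^ 2) := by
  induction n with
  | zero => simp
  | succ n ih =>
    have hw := h.w_pos n
    have htn := ht n
    obtain ⟨h1, h2⟩ := sol_nonneg h (sq_nonneg s) zero_le_one (le_refl (0 : ℝ)) n
    obtain ⟨h3, h4⟩ := sol_nonneg h (sq_nonneg s) zero_le_one (le_refl (0 : ℝ)) (n + 1)
    rw [Finset.prod_range_succ]
    have hE : 1 ≤ Real.exp (K / (n + 1)) := Real.one_le_exp (by positivity)
    -- In the balanced variables `a = u`, `B = (t / s) v` with `ρ = s t w`, one step is `B' = B + ρ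
    -- a`, `a' = a + ρ B + ρ² a`, so `a' + B' ≤ (1 + ρ)² (a + B)`. Passing from `t n` to `t (n + 1)`
    -- then costs the exponential factor.
    have hstep : (sol w q (s ^ 2) 1 0 (n + 1)).1 + t n / s * (sol w q (s ^ 2) 1 0 (n + 1)).2 ≤
        ((sol w q (s ^ 2) 1 0 n).1 + t n / s * (sol w q (s ^ 2) 1 0 n).2) *
          (1 + s * (t n * w n)) ^ 2 := by
      rw [sol_succ_fst, sol_succ_snd, hq n]
      set a := (sol w q (s ^ 2) 1 0 n).1
      set b := (sol w q (s ^ 2) 1 0 n).2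
      set ρ := s * (t n * w n) with hρ
      have hρ0 : 0 ≤ ρ := by positivity
      have e1 : t n ^ 2 * w n * (b + s ^ 2 * w n * a) = ρ * (t n / s * b) + ρ ^ 2 * a := by
        rw [hρ]; field_simp
      have e2 : t n / s * (b + s ^ 2 * w n * a) = t n / s * b + ρ * a := by
        rw [hρ]; field_simp
      rw [e1, e2]
      have hb : 0 ≤ t n / s * b := by positivity
      nlinarith [mul_nonneg hρ0 hb, mul_nonneg hρ0 h1, mul_nonneg (sq_nonneg ρ) hb]
    have h5 : t (n + 1) / s * (sol w q (s ^ 2) 1 0 (n + 1)).2 ≤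
        Real.exp (K / (n + 1)) * (t n / s * (sol w q (s ^ 2) 1 0 (n + 1)).2) := by
      calc _ ≤ (Real.exp (K / (n + 1)) * t n) / s * (sol w q (s ^ 2) 1 0 (n + 1)).2 := by
            gcongr
            exact hup n
        _ = _ := by ring
    calc _ ≤ Real.exp (K / (n + 1)) * ((sol w q (s ^ 2) 1 0 (n + 1)).1 +
          t n / s * (sol w q (s ^ 2) 1 0 (n + 1)).2) := by nlinarith
      _ ≤ Real.exp (K / (n + 1)) * ((∏ i ∈ Finset.range n,
          (Real.exp (K / (i + 1)) * (1 + s * (t i * w i)) ^ 2)) *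
            (1 + s * (t n * w n)) ^ 2) := by
          gcongr
          exact hstep.trans (by gcongr)
      _ = _ := by ring

end Real

end

/-! ### Two-sided bounds for the logarithm of the flux. -/

section

open Topology

/-- A regular string whose masses and lengths behave like powers with `w_n q_n ≈ (p n)^{-p}`. -/
structure PowerString (p : ℕ) (w q : ℕ → ℝ) : Prop extends RegularString w q where
  ratio : ∃ K : ℝ, 0 ≤ K ∧ ∀ n : ℕ,
    √(q (n + 1) / w (n + 1)) ≤ Real.exp (K / (n + 1)) * √(q n / w n) ∧
      √(q n / w n) ≤ Real.exp (K / (n + 1)) * √(q (n + 1) / w (n + 1))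
  tail : ∃ δ : ℝ, 0 < δ ∧ Summable fun n : ℕ => ((n : ℝ) + 1) ^ δ * w n
  mul_le : ∀ n : ℕ, ((p : ℝ) * n) ^ p * (w n * q n) ≤ 1
  le_mul : ∃ k : ℕ, 0 < k ∧ ∀ n : ℕ, 1 ≤ ((p : ℝ) * (k + n)) ^ p * (w n * q n)

/-- Identifies `y = x^(1/p) / p` as the scale on which `x (p a)^(-p)` becomes `(a / y)^(-p)`. -/
theorem div_scale_rpow {p : ℕ} (hp : 0 < p) {x a : ℝ} (hx : 0 < x) (ha : 0 < a) :
    (a / (x ^ (1 / (p : ℝ)) / p)) ^ (-(p : ℝ)) = x * (((p : ℝ) * a) ^ p)⁻¹ := by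
  have hp0 : (0 : ℝ) < p := by exact_mod_cast hp
  have h1 : 0 < x ^ (1 / (p : ℝ)) := Real.rpow_pos_of_pos hx _
  have h2 : (x ^ (1 / (p : ℝ))) ^ p = x := by
    rw [one_div]; exact Real.rpow_inv_natCast_pow hx.le hp.ne'
  rw [Real.rpow_neg (by positivity), Real.rpow_natCast, div_div_eq_mul_div, div_pow, h2, inv_div,
    mul_comm a, div_eq_mul_inv]

theorem sum_range_inv_succ_le (N : ℕ) :
    ∑ i ∈ Finset.range N, 1 / ((i : ℝ) + 1) ≤ 1 + Real.log N := by
  have := harmonic_le_one_add_log N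
  simp only [harmonic, Rat.cast_sum, Rat.cast_inv, Rat.cast_natCast] at this
  simpa using this

theorem log_one_add_mul_le {s c : ℝ} (hs : 1 ≤ s) (hc : 0 ≤ c) :
    Real.log (1 + s * c) ≤ Real.log s + Real.log (1 + c) := by
  rw [← Real.log_mul (by linarith) (by linarith)]
  exact Real.log_le_log (by positivity) (by nlinarith)

theorem PowerString.le_log_flux {p : ℕ} (hp : 3 ≤ p) {w q : ℕ → ℝ} (h : PowerString p w q) :
    ∃ C : ℝ, ∀ᶠ x : ℝ in atTop,
      lowerBound p * x ^ (1 / (p : ℝ)) - C * (1 + Real.log x) ≤ Real.log (flux w q x) := by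
  have hp3 : (3 : ℝ) ≤ p := by exact_mod_cast hp
  have hp0 : (0 : ℝ) < p := by linarith
  obtain ⟨k, hk, hkn⟩ := h.le_mul
  have hr := h.toRegularString
  set S := Real.pi / Real.sin (Real.pi / p) with hS
  have hS0 : 0 < S := div_pos Real.pi_pos (sin_pi_div_pos hp)
  have hw0 := h.w_pos 0
  have hQ : 0 ≤ ∑' i, q i := tsum_nonneg fun i => (h.q_pos i).le
  -- The index shift contributes `k p log y`, the integral near 0 contributes `S`, and the last term
  -- pays for replacing `1 + Q F` by `F (1 / w 0 + Q)`, where `F` is the flux, `Q` the total length,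
  -- and `F ≥ w 0`.
  refine ⟨k * p + S + |Real.log ((w 0)⁻¹ + ∑' i, q i)|, ?_⟩
  filter_upwards [eventually_ge_atTop (1 : ℝ),
    (tendsto_rpow_atTop (y := 1 / (p : ℝ)) (by positivity)).eventually_ge_atTop (p : ℝ)]
    with x hx hxp
  have hx0 : 0 < x := by linarith
  set y := x ^ (1 / (p : ℝ)) / p with hy
  have hy1 : 1 ≤ y := (one_le_div hp0).2 hxp
  have hf0 : 0 < flux w q x := lt_of_lt_of_le (mul_pos hx0 hw0) (mul_le_flux hr hx0.le)
  have hB := le_of_sum_log_one_add_le (m := p) (y := y) (by linarith) hy1 hk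
    (B := Real.log (1 + (∑' i, q i) * flux w q x)) fun N => by
      rw [← Real.log_prod fun i _ => by
        have : 0 < ((k : ℝ) + i) / y := by positivity
        have := Real.rpow_pos_of_pos this (-(p : ℝ))
        linarith]
      refine Real.log_le_log (Finset.prod_pos fun i _ => ?_)
        (le_trans (Finset.prod_le_prod (fun i _ => ?_) fun i _ => ?_)
          (prod_le_one_add_flux hr hx0.le N))
      · have : 0 < ((k : ℝ) + i) / y := by positivity
        have := Real.rpow_pos_of_pos this (-(p : ℝ))
        linarith
      · have : 0 < ((k : ℝ) + i) / y := by positivity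
        have := Real.rpow_pos_of_pos this (-(p : ℝ))
        linarith
      · rw [div_scale_rpow (by omega) hx0 (by positivity)]
        have h1 := hkn i
        have h2 : 0 < ((p : ℝ) * (k + i)) ^ p := by positivity
        gcongr
        rwa [inv_le_iff_one_le_mul₀' h2]
  have hlogx : 0 ≤ Real.log x := Real.log_nonneg hx
  have hly : Real.log y ≤ Real.log x := by
    refine Real.log_le_log (by linarith) ?_
    calc y ≤ x ^ (1 / (p : ℝ)) := div_le_self (by positivity) (by linarith)
      _ ≤ x ^ (1 : ℝ) := Real.rpow_le_rpow_of_exponent_le hx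
          ((div_le_one hp0).2 (by linarith))
      _ = x := Real.rpow_one x
  have hlog : Real.log (1 + (∑' i, q i) * flux w q x) ≤
      Real.log (flux w q x) + |Real.log ((w 0)⁻¹ + ∑' i, q i)| := by
    refine le_trans ?_ (add_le_add le_rfl (le_abs_self _))
    rw [← Real.log_mul hf0.ne' (by positivity)]
    refine Real.log_le_log (by positivity) ?_
    have h1 : w 0 ≤ flux w q x := le_trans (by nlinarith) (mul_le_flux hr hx0.le)
    have h2 : 1 ≤ flux w q x * (w 0)⁻¹ := by
      rw [← div_eq_mul_inv]; exact (one_le_div hw0).2 h1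
    linarith
  have hlb : lowerBound p * x ^ (1 / (p : ℝ)) = y * S := by
    rw [lowerBound, hy, hS, mul_comm (p : ℝ), ← div_div]; ring
  rw [hlb]
  have : (k : ℝ) * p * Real.log y ≤ k * p * Real.log x := by gcongr
  have := mul_nonneg (add_nonneg hS0.le (abs_nonneg (Real.log ((w 0)⁻¹ + ∑' i, q i)))) hlogx
  have : 0 ≤ (k : ℝ) * p := by positivity
  nlinarith

theorem PowerString.sum_log_le {p : ℕ} (hp : 3 ≤ p) {w q : ℕ → ℝ} (h : PowerString p w q) :
    ∃ C : ℝ, ∀ x : ℝ, 1 ≤ x → ∀ N : ℕ,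
      2 * ∑ i ∈ Finset.range N, Real.log (1 + √x * (√(q i / w i) * w i)) ≤
        upperBound p * x ^ (1 / (p : ℝ)) + 2 * Real.log x + C := by
  have hp3 : (3 : ℝ) ≤ p := by exact_mod_cast hp
  have hp0 : (0 : ℝ) < p := by linarith
  set c : ℕ → ℝ := fun i => √(q i / w i) * w i with hc
  have hc0 : ∀ i, 0 ≤ c i := fun i => mul_nonneg (Real.sqrt_nonneg _) (h.w_pos i).le
  have hc2 : ∀ i, c i ^ 2 = w i * q i := fun i => by
    have := h.w_pos i
    have := h.q_pos i
    simp only [hc, mul_pow]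
    rw [Real.sq_sqrt (by positivity)]
    field_simp
  refine ⟨2 * (Real.log (1 + c 0) + Real.log (1 + c 1)), fun x hx N => ?_⟩
  have hx0 : 0 < x := by linarith
  have hs1 : 1 ≤ √x := Real.one_le_sqrt.2 hx
  set y := x ^ (1 / (p : ℝ)) / p with hy
  have hy0 : 0 < y := by positivity
  have hnn : ∀ i, 0 ≤ Real.log (1 + √x * c i) := fun i =>
    Real.log_nonneg (by have := mul_nonneg (Real.sqrt_nonneg x) (hc0 i); linarith)
  -- Two extra terms are added so that indices 0 and 1 can be split off. Each of these costs `(log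
  -- x) / 2 + log (1 + c i)`, which after doubling gives `2 log x` and the chosen constant.
  have h1 : ∑ i ∈ Finset.range N, Real.log (1 + √x * c i) ≤
      ∑ i ∈ Finset.range (N + 2), Real.log (1 + √x * c i) :=
    Finset.sum_le_sum_of_subset_of_nonneg (Finset.range_mono (by omega)) fun i _ _ => hnn i
  rw [Finset.sum_range_succ', Finset.sum_range_succ'] at h1
  have h2 : ∑ i ∈ Finset.range N, Real.log (1 + √x * c (i + 1 + 1)) ≤
      y * (Real.pi / Real.sin (Real.pi / (p / 2))) := by
    refine le_trans (Finset.sum_le_sum fun i _ => ?_)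
      (sum_log_one_add_le (m := p / 2) (by linarith) hy0 N)
    have hpos : 0 < ((i : ℝ) + 2) / y := by positivity
    refine Real.log_le_log (by have := mul_nonneg (Real.sqrt_nonneg x) (hc0 (i + 1 + 1)); linarith)
      (add_le_add le_rfl ?_)
    -- Squaring replaces `c i` by `√(w i * q i)` squared, to which the hypothesis on `w i * q i`
    -- applies; this is where the exponent `p / 2` comes from.
    refine le_of_sq_le_sq ?_ (Real.rpow_nonneg hpos.le _)
    rw [← Real.rpow_natCast, ← Real.rpow_natCast, ← Real.rpow_mul hpos.le]
    rw [show -((p : ℝ) / 2) * ((2 : ℕ) : ℝ) = -(p : ℝ) by push_cast; ring,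
      div_scale_rpow (by omega) hx0 (by positivity), Real.rpow_natCast, mul_pow, hc2,
      Real.sq_sqrt hx0.le]
    gcongr
    have := h.mul_le (i + 1 + 1)
    have e : (((i + 1 + 1 : ℕ) : ℝ)) = (i : ℝ) + 2 := by push_cast; ring
    rw [e] at this
    rw [le_inv_comm₀ (mul_pos (h.w_pos _) (h.q_pos _)) (by positivity), ← one_div,
      le_div_iff₀ (mul_pos (h.w_pos _) (h.q_pos _))]
    exact this
  have hls : Real.log (√x) = Real.log x / 2 := Real.log_sqrt hx0.le
  have h3 := log_one_add_mul_le hs1 (hc0 0)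
  have h4 := log_one_add_mul_le hs1 (hc0 1)
  have hub : upperBound p * x ^ (1 / (p : ℝ)) =
      2 * (y * (Real.pi / Real.sin (Real.pi / (p / 2)))) := by
    rw [upperBound_eq, hy]; ring
  rw [hub]
  simp only [zero_add] at h1
  linarith

/-- The energy estimate loses a factor of size a power of the index, so it is used only up to an
index `N` polynomial in `x`. From there on, `x` times the remaining mass is bounded and the crude
exponential estimate costs `O(1)`. -/
theorem PowerString.log_flux_le {p : ℕ} (hp : 3 ≤ p) {w q : ℕ → ℝ} (h : PowerString p w q) :
    ∃ C : ℝ, ∀ x : ℝ, 1 ≤ x →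
      Real.log (flux w q x) ≤ upperBound p * x ^ (1 / (p : ℝ)) + C * (1 + Real.log x) := by
  obtain ⟨C₀, hC₀⟩ := h.sum_log_le hp
  obtain ⟨K, hK, hratio⟩ := h.ratio
  obtain ⟨δ, hδ, htail⟩ := h.tail
  have hr := h.toRegularString
  set t : ℕ → ℝ := fun n => √(q n / w n) with ht
  have ht0 : ∀ n, 0 < t n := fun n => Real.sqrt_pos.2 (div_pos (h.q_pos n) (h.w_pos n))
  have htq : ∀ n, q n = t n ^ 2 * w n := fun n => by
    have := h.w_pos n
    have := h.q_pos n
    simp only [ht]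
    rw [Real.sq_sqrt (by positivity)]
    field_simp
  set W := ∑' n : ℕ, ((n : ℝ) + 1) ^ δ * w n with hW
  set Q := ∑' i, q i with hQ
  have hW0 : 0 ≤ W := tsum_nonneg fun n => mul_nonneg (by positivity) (h.w_pos n).le
  have hQ0 : 0 ≤ Q := tsum_nonneg fun n => (h.q_pos n).le
  have hl2 : 0 ≤ Real.log 2 := Real.log_nonneg one_le_two
  have hlt : 0 ≤ Real.log (1 + (t 0)⁻¹) :=
    Real.log_nonneg (by have := inv_pos.2 (ht0 0); linarith)
  -- `W + Q` comes from the tail beyond `N`, `3` covers `5/2` multiples of `log x`, and the `K` term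
  -- covers two factors `exp (K * H)`, with `H` the harmonic sum up to `N`.
  refine ⟨W + Q + |C₀| + 3 + Real.log (1 + (t 0)⁻¹) + 2 * K * (1 + Real.log 2 + 1 / δ),
    fun x hx => ?_⟩
  have hx0 : 0 < x := by linarith
  have hlx : 0 ≤ Real.log x := Real.log_nonneg hx
  have hs1 : 1 ≤ √x := Real.one_le_sqrt.2 hx
  have hs0 : 0 < √x := by linarith
  -- Chosen so that `N^δ ≥ x`, which absorbs `x` into the weighted mass sum `W`, while `log N` stays
  -- `O(1 + log x)`.
  set N := ⌈x ^ (1 / δ)⌉₊ with hN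
  have hxd : 1 ≤ x ^ (1 / δ) := Real.one_le_rpow hx (by positivity)
  have hN0 : 0 < N := Nat.ceil_pos.2 (by linarith)
  have hNx : x ^ (1 / δ) ≤ N := Nat.le_ceil _
  have hxN : x ≤ (N : ℝ) ^ δ := by
    calc x = (x ^ (1 / δ)) ^ δ := by
          rw [← Real.rpow_mul hx0.le, one_div_mul_cancel hδ.ne', Real.rpow_one]
      _ ≤ _ := Real.rpow_le_rpow (by linarith) hNx hδ.le
  have hlogN : Real.log N ≤ Real.log 2 + 1 / δ * Real.log x := by
    rw [← Real.log_rpow hx0, ← Real.log_mul two_ne_zero (by linarith)]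
    refine Real.log_le_log (by exact_mod_cast hN0) ?_
    have := Nat.ceil_lt_add_one (show 0 ≤ x ^ (1 / δ) by linarith)
    linarith
  set H := ∑ i ∈ Finset.range N, 1 / ((i : ℝ) + 1) with hH
  have hHN : H ≤ 1 + Real.log N := sum_range_inv_succ_le N
  have hH0 : 0 ≤ H := Finset.sum_nonneg fun i _ => by positivity
  have htN : (t N)⁻¹ ≤ Real.exp (K * H) * (t 0)⁻¹ := by
    have : ∀ n : ℕ, t 0 ≤ Real.exp (K * ∑ i ∈ Finset.range n, 1 / ((i : ℝ) + 1)) * t n := by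
      intro n
      induction n with
      | zero => simp
      | succ n ih =>
        rw [Finset.sum_range_succ, mul_add, Real.exp_add, mul_one_div, mul_assoc]
        refine ih.trans (mul_le_mul_of_nonneg_left (hratio n).2 (Real.exp_pos _).le)
    have := this N
    have h0 := ht0 0
    have hN' := ht0 N
    rw [← div_eq_mul_inv, le_div_iff₀ h0, inv_mul_le_iff₀ hN', mul_comm]
    exact this
  have hwt : x * ∑' i, w (N + i) ≤ W := by
    have hws : Summable fun i => w (N + i) := by
      simpa only [add_comm] using (summable_nat_add_iff N).2 h.w_summable
    have hts : Summable fun i : ℕ => (((N + i : ℕ) : ℝ) + 1) ^ δ * w (N + i) := by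
      simpa only [add_comm] using (summable_nat_add_iff N).2 htail
    rw [← tsum_mul_left]
    refine le_trans (Summable.tsum_le_tsum (fun i => ?_) (hws.mul_left x) hts) ?_
    · refine mul_le_mul_of_nonneg_right (hxN.trans ?_) (h.w_pos _).le
      exact Real.rpow_le_rpow (by positivity) (by push_cast; linarith [Nat.cast_nonneg (α := ℝ) i])
        hδ.le
    · rw [hW, ← htail.sum_add_tsum_nat_add N]
      have : ∑' i : ℕ, (((N + i : ℕ) : ℝ) + 1) ^ δ * w (N + i)
          = ∑' i : ℕ, (((i + N : ℕ) : ℝ) + 1) ^ δ * w (i + N) := by simp only [add_comm]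
      rw [this]
      refine le_add_of_nonneg_left (Finset.sum_nonneg fun n _ => ?_)
      exact mul_nonneg (by positivity) (h.w_pos n).le
  set P := ∏ i ∈ Finset.range N, (1 + √x * (t i * w i)) with hP
  have hfac : ∀ i, 1 ≤ 1 + √x * (t i * w i) := fun i => by
    have := mul_nonneg hs0.le (mul_nonneg (ht0 i).le (h.w_pos i).le)
    linarith
  have hP0 : 0 < P := Finset.prod_pos fun i _ => by linarith [hfac i]
  have hen := energy_le hr hs0 hK ht0 htq (fun n => (hratio n).1) N
  rw [Real.sq_sqrt hx0.le, Finset.prod_mul_distrib, ← Real.exp_sum, Finset.prod_pow, ← hP] at hen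
  have hKH : ∑ i ∈ Finset.range N, K / ((i : ℝ) + 1) = K * H := by
    rw [hH, Finset.mul_sum]
    exact Finset.sum_congr rfl fun i _ => by rw [mul_one_div]
  rw [hKH] at hen
  obtain ⟨hu, hv⟩ := sol_nonneg hr hx0.le zero_le_one (le_refl (0 : ℝ)) N
  -- Returns from the energy to `u + v`: the factor `1 + √x / t N` restores the coefficient of `v`,
  -- and `htN` bounds `1 / t N`.
  have huv : (sol w q x 1 0 N).1 + (sol w q x 1 0 N).2 ≤
      (1 + √x * (Real.exp (K * H) * (t 0)⁻¹)) * (Real.exp (K * H) * P ^ 2) := by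
    have h0 := ht0 N
    calc _ ≤ (1 + √x * (t N)⁻¹) *
          ((sol w q x 1 0 N).1 + t N / √x * (sol w q x 1 0 N).2) := by
          have e : (1 + √x * (t N)⁻¹) *
            ((sol w q x 1 0 N).1 + t N / √x * (sol w q x 1 0 N).2) =
            (sol w q x 1 0 N).1 + (sol w q x 1 0 N).2 +
              (√x * (t N)⁻¹ * (sol w q x 1 0 N).1 + t N / √x * (sol w q x 1 0 N).2) := by
            field_simp
            ring
          rw [e]
          have : 0 ≤ √x * (t N)⁻¹ * (sol w q x 1 0 N).1 + t N / √x * (sol w q x 1 0 N).2 := by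
            positivity
          linarith
      _ ≤ _ := by gcongr
  have hflux : flux w q x ≤
      (1 + √x * (Real.exp (K * H) * (t 0)⁻¹)) * (Real.exp (K * H) * P ^ 2) *
        Real.exp (W + Q) := by
    refine flux_le hr hx0.le (N := N) fun n => ?_
    have h1 := sol_add_le_mul_exp_tsum hr hx0.le zero_le_one (le_refl (0 : ℝ)) N n
    have h2 := (sol_nonneg hr hx0.le zero_le_one (le_refl (0 : ℝ)) (N + n)).1
    refine le_trans (by linarith) (h1.trans ?_)
    have : Real.exp (x * (∑' i, w (N + i)) + ∑' i, q i) ≤ Real.exp (W + Q) :=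
      Real.exp_le_exp.2 (by linarith)
    gcongr
  have hf0 : 0 < flux w q x := lt_of_lt_of_le (mul_pos hx0 (h.w_pos 0)) (mul_le_flux hr hx0.le)
  have ht00 := inv_pos.2 (ht0 0)
  have hlog := Real.log_le_log hf0 hflux
  rw [Real.log_mul (by positivity) (by positivity), Real.log_exp,
    Real.log_mul (by positivity) (by positivity), Real.log_mul (by positivity) (by positivity),
    Real.log_exp, Real.log_pow] at hlog
  have hl1 : Real.log (1 + √x * (Real.exp (K * H) * (t 0)⁻¹)) ≤
      Real.log x / 2 + K * H + Real.log (1 + (t 0)⁻¹) := by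
    refine (log_one_add_mul_le hs1 (by positivity)).trans ?_
    rw [Real.log_sqrt hx0.le]
    have := log_one_add_mul_le (Real.one_le_exp (mul_nonneg hK hH0)) ht00.le
    rw [Real.log_exp] at this
    linarith
  have hlP : 2 * Real.log P ≤ upperBound p * x ^ (1 / (p : ℝ)) + 2 * Real.log x + C₀ := by
    rw [hP, Real.log_prod fun i _ => by linarith [hfac i]]
    exact hC₀ x hx N
  push_cast at hlog
  have hKH2 : K * H ≤ K * (1 + Real.log 2 + 1 / δ * Real.log x) :=
    mul_le_mul_of_nonneg_left (by linarith) hK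
  have h5 := le_abs_self C₀
  have h6 : 0 ≤ (W + Q + |C₀| + Real.log (1 + (t 0)⁻¹) + 2 * K * (1 + Real.log 2)) *
      Real.log x := by positivity
  have h7 : 0 ≤ 2 * K * (1 / δ) := by positivity
  nlinarith

end

/-! ### Orthogonal polynomials as string displacements; normal form of the Nevanlinna matrix. -/

section

open Topology

/-- The solution of the string equation at complex spectral parameter. -/
def csol (w q : ℕ → ℝ) (z : ℂ) (u v : ℝ) (n : ℕ) : ℂ :=
  (sol (fun k => (w k : ℂ)) (fun k => (q k : ℂ)) z (u : ℂ) (v : ℂ) n).1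

/-- The masses of the string that belongs to birth rates `lam` and death rates `mu`. -/
def mass (lam mu : ℕ → ℝ) (n : ℕ) : ℝ := ∏ i ∈ Finset.range n, (lam i / mu (i + 1))

/-- The lengths of the string that belongs to birth rates `lam` and death rates `mu`. -/
def len (lam mu : ℕ → ℝ) (n : ℕ) : ℝ := 1 / (lam n * mass lam mu n)

theorem mass_pos {lam mu : ℕ → ℝ} (hl : ∀ n, 0 < lam n) (hm : ∀ n, 0 < mu (n + 1)) (n : ℕ) :
    0 < mass lam mu n := Finset.prod_pos fun i _ => div_pos (hl i) (hm i)

theorem mass_succ (lam mu : ℕ → ℝ) (n : ℕ) :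
    mass lam mu (n + 1) = mass lam mu n * (lam n / mu (n + 1)) := Finset.prod_range_succ _ _

section Recurrence

variable {lam mu : ℕ → ℝ}

theorem sqrt_mul_sqrt_mass_succ (hl : ∀ n, 0 < lam n) (hm : ∀ n, 0 < mu (n + 1)) (n : ℕ) :
    √(lam n * mu (n + 1)) * √(mass lam mu (n + 1)) = lam n * √(mass lam mu n) := by
  have := hm n
  have := hl n
  rw [mass_succ, ← Real.sqrt_mul (by positivity),
    show lam n * mu (n + 1) * (mass lam mu n * (lam n / mu (n + 1))) = lam n ^ 2 * mass lam mu n by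
      field_simp, Real.sqrt_mul (by positivity), Real.sqrt_sq (by positivity)]

theorem sqrt_mul_sqrt_mass (hl : ∀ n, 0 < lam n) (hm : ∀ n, 0 < mu (n + 1)) (n : ℕ) :
    √(lam n * mu (n + 1)) * √(mass lam mu n) = mu (n + 1) * √(mass lam mu (n + 1)) := by
  have := hm n
  have := hl n
  have := mass_pos hl hm n
  rw [mass_succ, ← Real.sqrt_mul (by positivity), ← Real.sqrt_sq (hm n).le,
    ← Real.sqrt_mul (by positivity)]
  congr 1
  rw [Real.sqrt_sq (hm n).le]
  field_simp

/-- Elimination of the slope `v` from two consecutive steps, using the detailed balance `λ_n w_n =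
μ_(n+1) w_(n+1)`. -/
theorem csol_recurrence (hl : ∀ n, 0 < lam n) (hm : ∀ n, 0 < mu (n + 1)) (z : ℂ) (u v : ℝ)
    (n : ℕ) : (lam (n + 1) : ℂ) * csol (mass lam mu) (len lam mu) (-z) u v (n + 2) =
      (lam (n + 1) + mu (n + 1) - z) * csol (mass lam mu) (len lam mu) (-z) u v (n + 1) -
        mu (n + 1) * csol (mass lam mu) (len lam mu) (-z) u v n := by
  have h1 : (lam (n + 1) : ℂ) ≠ 0 := by exact_mod_cast (hl (n + 1)).ne'
  have h2 : (mass lam mu (n + 1) : ℂ) ≠ 0 := by exact_mod_cast (mass_pos hl hm (n + 1)).ne'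
  have h3 : (lam n : ℂ) ≠ 0 := by exact_mod_cast (hl n).ne'
  have h4 : (mass lam mu n : ℂ) ≠ 0 := by exact_mod_cast (mass_pos hl hm n).ne'
  have h5 : (mu (n + 1) : ℂ) ≠ 0 := by exact_mod_cast (hm n).ne'
  have e : (lam n : ℂ) * mass lam mu n = mu (n + 1) * mass lam mu (n + 1) := by
    rw [mass_succ]; push_cast; field_simp
  unfold csol
  rw [sol_succ_fst _ _ _ _ _ (n + 1), sol_succ_snd _ _ _ _ _ (n + 1), sol_succ_fst _ _ _ _ _ n]
  generalize (sol (fun k => (mass lam mu k : ℂ)) (fun k => (len lam mu k : ℂ)) (-z) u v (n + 1)).2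
    = y
  generalize (sol (fun k => (mass lam mu k : ℂ)) (fun k => (len lam mu k : ℂ)) (-z) u v n).1 = x
  have q1 : (len lam mu n : ℂ) = 1 / (mu (n + 1) * mass lam mu (n + 1)) := by
    rw [← e, len]; push_cast; rfl
  have q2 : (len lam mu (n + 1) : ℂ) = 1 / (lam (n + 1) * mass lam mu (n + 1)) := by
    rw [len]; push_cast; rfl
  rw [q1, q2]
  field_simp
  ring

/-- The induction step shared by the two systems of polynomials. -/
theorem recurrence_step (hl : ∀ n, 0 < lam n) (hm : ∀ n, 0 < mu (n + 1)) (z : ℂ) (u v : ℝ)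
    (n : ℕ) :
    ((z - ((lam (n + 1) + mu (n + 1) : ℝ) : ℂ)) * ((-1) ^ (n + 1) * (√(mass lam mu (n + 1)) : ℂ) *
          csol (mass lam mu) (len lam mu) (-z) u v (n + 1)) -
        (√(lam n * mu (n + 1)) : ℂ) * ((-1) ^ n * (√(mass lam mu n) : ℂ) *
          csol (mass lam mu) (len lam mu) (-z) u v n)) / (√(lam (n + 1) * mu (n + 2)) : ℂ) =
      (-1) ^ (n + 2) * (√(mass lam mu (n + 2)) : ℂ) *
        csol (mass lam mu) (len lam mu) (-z) u v (n + 2) := by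
  have hb : (√(lam (n + 1) * mu (n + 2)) : ℂ) ≠ 0 := by
    exact_mod_cast (Real.sqrt_pos.2 (mul_pos (hl _) (hm _))).ne'
  have e1 : (√(lam (n + 1) * mu (n + 2)) : ℂ) * (√(mass lam mu (n + 2)) : ℂ)
      = lam (n + 1) * (√(mass lam mu (n + 1)) : ℂ) := by
    exact_mod_cast sqrt_mul_sqrt_mass_succ hl hm (n + 1)
  have e2 : (√(lam n * mu (n + 1)) : ℂ) * (√(mass lam mu n) : ℂ)
      = mu (n + 1) * (√(mass lam mu (n + 1)) : ℂ) := by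
    exact_mod_cast sqrt_mul_sqrt_mass hl hm n
  have e3 := csol_recurrence hl hm z u v n
  rw [div_eq_iff hb]
  push_cast
  linear_combination (-(-1) ^ n * csol (mass lam mu) (len lam mu) (-z) u v n) * e2
    - (-1) ^ n * csol (mass lam mu) (len lam mu) (-z) u v (n + 2) * e1
    - (-1) ^ n * (√(mass lam mu (n + 1)) : ℂ) * e3

/-- The weight `√w` symmetrizes the recurrence and the sign makes its off-diagonal coefficients
positive. Since `μ_0 = 0`, the start `(1, 0)` reproduces `P_1`. -/
theorem P_eq (hl : ∀ n, 0 < lam n) (hm : ∀ n, 0 < mu (n + 1)) (h0 : mu 0 = 0) (z : ℂ) (n : ℕ) :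
    P (fun n => lam n + mu n) (fun n => √(lam n * mu (n + 1))) n z =
      (-1) ^ n * (√(mass lam mu n) : ℂ) * csol (mass lam mu) (len lam mu) (-z) 1 0 n := by
  induction n using Nat.twoStepInduction with
  | zero => simp [P, csol, mass]
  | one =>
    have hb : (√(lam 0 * mu 1) : ℂ) ≠ 0 := by
      exact_mod_cast (Real.sqrt_pos.2 (mul_pos (hl _) (hm _))).ne'
    have e1 : (√(lam 0 * mu 1) : ℂ) * (√(mass lam mu 1) : ℂ)
        = lam 0 * (√(mass lam mu 0) : ℂ) := by
      exact_mod_cast sqrt_mul_sqrt_mass_succ hl hm 0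
    have hl0 : (lam 0 : ℂ) ≠ 0 := by exact_mod_cast (hl 0).ne'
    have hm0 : mass lam mu 0 = 1 := by simp [mass]
    have hc : (lam 0 : ℂ) * csol (mass lam mu) (len lam mu) (-z) 1 0 1 = lam 0 - z := by
      simp only [csol, sol, len, hm0]
      push_cast
      field_simp
      ring
    rw [hm0] at e1
    simp only [P, h0]
    rw [div_eq_iff hb]
    push_cast
    simp only [Real.sqrt_one, Complex.ofReal_one] at e1
    linear_combination csol (mass lam mu) (len lam mu) (-z) 1 0 1 * e1 + hc
  | more n ih1 ih2 =>
    rw [P, ih1, ih2]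
    exact recurrence_step hl hm z 1 0 n

theorem Q_eq (hl : ∀ n, 0 < lam n) (hm : ∀ n, 0 < mu (n + 1)) (z : ℂ) (n : ℕ) :
    Q (fun n => lam n + mu n) (fun n => √(lam n * mu (n + 1))) n z =
      -((-1) ^ n * (√(mass lam mu n) : ℂ) * csol (mass lam mu) (len lam mu) (-z) 0 1 n) := by
  induction n using Nat.twoStepInduction with
  | zero => simp [Q, csol]
  | one =>
    have hb : (√(lam 0 * mu 1) : ℂ) ≠ 0 := by
      exact_mod_cast (Real.sqrt_pos.2 (mul_pos (hl _) (hm _))).ne'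
    have e1 : (√(lam 0 * mu 1) : ℂ) * (√(mass lam mu 1) : ℂ)
        = lam 0 * (√(mass lam mu 0) : ℂ) := by
      exact_mod_cast sqrt_mul_sqrt_mass_succ hl hm 0
    have hl0 : (lam 0 : ℂ) ≠ 0 := by exact_mod_cast (hl 0).ne'
    have hm0 : mass lam mu 0 = 1 := by simp [mass]
    have hc : (lam 0 : ℂ) * csol (mass lam mu) (len lam mu) (-z) 0 1 1 = 1 := by
      simp only [csol, sol, len, hm0]
      push_cast
      field_simp
      ring
    rw [hm0] at e1
    simp only [Q]
    rw [div_eq_iff hb]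
    simp only [Real.sqrt_one, Complex.ofReal_one] at e1
    linear_combination -csol (mass lam mu) (len lam mu) (-z) 0 1 1 * e1 - hc
  | more n ih1 ih2 =>
    rw [Q, ih1, ih2, ← recurrence_step hl hm z 0 1 n]
    ring

end Recurrence

/-- At parameter 0 the slope is constant. So `P_k(0)` contributes the weight 1 to the Nevanlinna
series, and `Q_k(0)` the sum of the first `k` lengths. -/
theorem csol_zero_left (w q : ℕ → ℝ) (u v : ℝ) (n : ℕ) :
    csol w q 0 u v n = ((u + v * ∑ i ∈ Finset.range n, q i : ℝ) : ℂ) := by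
  have h : ∀ n, (sol w q 0 u v n).2 = v := fun n => by rw [sol_snd_eq_sum]; simp
  have h2 := sol_ofReal w q 0 u v n
  rw [csol, ← Complex.ofReal_zero, h2, sol_fst_eq_sum]
  simp only [h, Finset.mul_sum, mul_comm]

section NormalForm

variable {lam mu : ℕ → ℝ}

/-- The entire functions that the entries of the Nevanlinna matrix are made of. -/
def series (w q θ : ℕ → ℝ) (u v : ℝ) (z : ℂ) : ℂ := ∑' k, ((θ k * w k : ℝ) : ℂ) * csol w q z u v k

theorem sign_mul_sqrt_mul (w : ℝ) (hw : 0 ≤ w) (n : ℕ) (x y : ℂ) :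
    ((-1) ^ n * (√w : ℂ) * x) * ((-1) ^ n * (√w : ℂ) * y) = w * (x * y) := by
  have h1 : (√w : ℂ) * (√w : ℂ) = w := by exact_mod_cast Real.mul_self_sqrt hw
  have h2 : ((-1 : ℂ) ^ n) * (-1) ^ n = 1 := by rw [← mul_pow]; simp
  linear_combination (x * y * (√w : ℂ) * (√w : ℂ)) * h2 + x * y * h1

/-- The trivial `0 + 1 *` fits the shape `c + σ * (z * series (-z))` shared by the four entries, so
that one growth estimate serves all of them. -/
theorem nevD_eq (hl : ∀ n, 0 < lam n) (hm : ∀ n, 0 < mu (n + 1)) (h0 : mu 0 = 0) (z : ℂ) :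
    nevD (fun n => lam n + mu n) (fun n => √(lam n * mu (n + 1))) z =
      0 + 1 * (z * series (mass lam mu) (len lam mu) (fun _ => 1) 1 0 (-z)) := by
  rw [nevD, series, zero_add, one_mul]
  congr 2
  ext k
  rw [P_eq hl hm h0, P_eq hl hm h0, sign_mul_sqrt_mul _ (mass_pos hl hm k).le, neg_zero,
    csol_zero_left]
  push_cast
  ring

theorem nevC_eq (hl : ∀ n, 0 < lam n) (hm : ∀ n, 0 < mu (n + 1)) (h0 : mu 0 = 0) (z : ℂ) :
    nevC (fun n => lam n + mu n) (fun n => √(lam n * mu (n + 1))) z =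
      1 + (-1) * (z * series (mass lam mu) (len lam mu) (fun _ => 1) 0 1 (-z)) := by
  rw [nevC, series, neg_one_mul, ← mul_neg, ← tsum_neg]
  congr 3
  ext k
  rw [P_eq hl hm h0, Q_eq hl hm, mul_neg, sign_mul_sqrt_mul _ (mass_pos hl hm k).le, neg_zero,
    csol_zero_left]
  push_cast
  ring

theorem nevB_eq (hl : ∀ n, 0 < lam n) (hm : ∀ n, 0 < mu (n + 1)) (h0 : mu 0 = 0) (z : ℂ) :
    nevB (fun n => lam n + mu n) (fun n => √(lam n * mu (n + 1))) z =
      -1 + (-1) * (z * series (mass lam mu) (len lam mu)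
        (fun k => ∑ i ∈ Finset.range k, len lam mu i) 1 0 (-z)) := by
  rw [nevB, series, neg_one_mul (z * _), ← mul_neg, ← tsum_neg]
  congr 3
  ext k
  rw [P_eq hl hm h0, Q_eq hl hm, neg_mul, sign_mul_sqrt_mul _ (mass_pos hl hm k).le, neg_zero,
    csol_zero_left]
  push_cast
  ring

theorem nevA_eq (hl : ∀ n, 0 < lam n) (hm : ∀ n, 0 < mu (n + 1)) (z : ℂ) :
    nevA (fun n => lam n + mu n) (fun n => √(lam n * mu (n + 1))) z =
      0 + 1 * (z * series (mass lam mu) (len lam mu)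
        (fun k => ∑ i ∈ Finset.range k, len lam mu i) 0 1 (-z)) := by
  rw [nevA, series, zero_add, one_mul]
  congr 2
  ext k
  rw [Q_eq hl hm, Q_eq hl hm, neg_mul_neg, sign_mul_sqrt_mul _ (mass_pos hl hm k).le, neg_zero,
    csol_zero_left]
  push_cast
  ring

end NormalForm

section Estimates

variable {w q θ : ℕ → ℝ} {u v : ℝ}

theorem norm_csol_le (h : RegularString w q) {z : ℂ} {r : ℝ} (hz : ‖z‖ ≤ r) (hu : 0 ≤ u)
    (hv : 0 ≤ v) (n : ℕ) : ‖csol w q z u v n‖ ≤ (sol w q r u v n).1 :=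
  (norm_sol_le h hz (Complex.norm_of_nonneg hu).le (Complex.norm_of_nonneg hv).le n).1

theorem summable_weight_mul_sol (h : RegularString w q) {r Θ : ℝ} (hr : 0 ≤ r) (hu : 0 ≤ u)
    (hv : 0 ≤ v) (hθ : ∀ k, 0 ≤ θ k) (hΘ : ∀ k, θ k ≤ Θ) :
    Summable fun k => θ k * w k * (sol w q r u v k).1 := by
  refine Summable.of_nonneg_of_le
    (fun k => mul_nonneg (mul_nonneg (hθ k) (h.w_pos k).le) (sol_nonneg h hr hu hv k).1)
    (fun k => ?_) ((summable_mul_sol h hr hu hv).mul_left Θ)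
  rw [mul_assoc]
  exact mul_le_mul_of_nonneg_right (hΘ k)
    (mul_nonneg (h.w_pos k).le (sol_nonneg h hr hu hv k).1)

theorem norm_series_term_le (h : RegularString w q) {z : ℂ} {r : ℝ} (hz : ‖z‖ ≤ r) (hu : 0 ≤ u)
    (hv : 0 ≤ v) (hθ : ∀ k, 0 ≤ θ k) (k : ℕ) :
    ‖((θ k * w k : ℝ) : ℂ) * csol w q z u v k‖ ≤ θ k * w k * (sol w q r u v k).1 := by
  have h1 := mul_nonneg (hθ k) (h.w_pos k).le
  rw [norm_mul, Complex.norm_of_nonneg h1]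
  exact mul_le_mul_of_nonneg_left (norm_csol_le h hz hu hv k) h1

theorem norm_series_le (h : RegularString w q) {z : ℂ} {r Θ : ℝ} (hz : ‖z‖ ≤ r) (hu : 0 ≤ u)
    (hv : 0 ≤ v) (hθ : ∀ k, 0 ≤ θ k) (hΘ : ∀ k, θ k ≤ Θ) :
    ‖series w q θ u v z‖ ≤ ∑' k, θ k * w k * (sol w q r u v k).1 :=
  tsum_of_norm_bounded
    (summable_weight_mul_sol h ((norm_nonneg z).trans hz) hu hv hθ hΘ).hasSum
    (norm_series_term_le h hz hu hv hθ)

theorem series_ofReal (w q θ : ℕ → ℝ) (u v r : ℝ) :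
    series w q θ u v (r : ℂ) = ((∑' k, θ k * w k * (sol w q r u v k).1 : ℝ) : ℂ) := by
  rw [series, Complex.ofReal_tsum]
  congr 1
  ext k
  rw [csol, sol_ofReal]
  push_cast
  rfl

theorem differentiable_sol (w q : ℕ → ℂ) (u v : ℂ) (n : ℕ) :
    Differentiable ℂ (fun z => (sol w q z u v n).1) ∧
      Differentiable ℂ (fun z => (sol w q z u v n).2) := by
  induction n with
  | zero => simp
  | succ n ih =>
    obtain ⟨h1, h2⟩ := ih
    simp only [sol]
    constructor <;> fun_prop

theorem differentiable_series (h : RegularString w q) {Θ : ℝ} (hu : 0 ≤ u)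
    (hv : 0 ≤ v) (hθ : ∀ k, 0 ≤ θ k) (hΘ : ∀ k, θ k ≤ Θ) :
    Differentiable ℂ (series w q θ u v) := by
  intro z
  have hd : DifferentiableOn ℂ (series w q θ u v) (Metric.ball 0 (‖z‖ + 1)) := by
    refine Complex.differentiableOn_tsum_of_summable_norm
      (summable_weight_mul_sol h (r := ‖z‖ + 1) (by positivity) hu hv hθ hΘ)
      (fun k => ?_) Metric.isOpen_ball fun k y hy => ?_
    · exact ((differentiable_sol _ _ _ _ k).1.const_mul _).differentiableOn
    · exact norm_series_term_le h (by simpa using (mem_ball_zero_iff.1 hy).le) hu hv hθ k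
  exact hd.differentiableAt (Metric.isOpen_ball.mem_nhds (by simp))

theorem bddAbove_norm_image_sphere {f : ℂ → ℂ} (hf : Differentiable ℂ f) (r : ℝ) :
    BddAbove ((fun z => ‖f z‖) '' Metric.sphere 0 r) :=
  (isCompact_sphere (0 : ℂ) r).bddAbove_image hf.continuous.norm.continuousOn

/-- All weights are nonnegative and the solution at `z` is majorized by the one at `|z|`; hence the
modulus is extremal at `z = -r`, up to the constant `c`. -/
theorem maxModulus_le_and_le (h : RegularString w q) {r Θ : ℝ} (hr : 0 ≤ r) (hu : 0 ≤ u)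
    (hv : 0 ≤ v) (hθ : ∀ k, 0 ≤ θ k) (hΘ : ∀ k, θ k ≤ Θ) {c σ : ℂ} (hc : ‖c‖ ≤ 1)
    (hσ : ‖σ‖ = 1) {f : ℂ → ℂ} (hf : ∀ z, f z = c + σ * (z * series w q θ u v (-z))) :
    maxModulus f r ≤ 1 + r * ∑' k, θ k * w k * (sol w q r u v k).1 ∧
      r * (∑' k, θ k * w k * (sol w q r u v k).1) - 1 ≤ maxModulus f r := by
  have hs0 : 0 ≤ ∑' k, θ k * w k * (sol w q r u v k).1 := tsum_nonneg fun k =>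
    mul_nonneg (mul_nonneg (hθ k) (h.w_pos k).le) (sol_nonneg h hr hu hv k).1
  have hd : Differentiable ℂ f := by
    have := differentiable_series h hu hv hθ hΘ
    rw [show f = fun z => c + σ * (z * series w q θ u v (-z)) from funext hf]
    fun_prop
  constructor
  · refine csSup_le ((NormedSpace.sphere_nonempty.2 hr).image _) ?_
    rintro _ ⟨z, hz, rfl⟩
    have hz' : ‖z‖ = r := by simpa using hz
    simp only [hf]
    refine (norm_add_le _ _).trans (add_le_add hc ?_)
    rw [norm_mul, hσ, one_mul, norm_mul, hz']
    exact mul_le_mul_of_nonneg_left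
      (norm_series_le h (by rw [norm_neg, hz']) hu hv hθ hΘ) hr
  · refine le_csSup_of_le (bddAbove_norm_image_sphere hd r)
      ⟨((-r : ℝ) : ℂ), by simp [abs_of_nonneg hr], rfl⟩ ?_
    simp only [hf]
    rw [← Complex.ofReal_neg, neg_neg, series_ofReal, ← Complex.ofReal_mul]
    have h1 := norm_sub_norm_le
      (σ * ((-r * ∑' k, θ k * w k * (sol w q r u v k).1 : ℝ) : ℂ)) (-c)
    rw [norm_mul, hσ, one_mul, Complex.norm_real, neg_mul, norm_neg, Real.norm_of_nonneg
      (mul_nonneg hr hs0), norm_neg, sub_neg_eq_add, add_comm _ c, ← neg_mul] at h1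
    linarith

end Estimates

end

/-! ### Comparison of the four entries with the flux; order and type from a gauge. -/

section

open Topology

section Comparison

variable {w q θ : ℕ → ℝ} {u v : ℝ}

/-- The weights `θ` and initial values `(u, v)` give a solution comparable to the one that starts
at `(1, 0)`, up to a factor linear in the spectral parameter. -/
def Comparable (w q θ : ℕ → ℝ) (u v : ℝ) : Prop :=
  ∃ c C : ℝ, 0 < c ∧ ∀ x : ℝ, 1 ≤ x →
    (∀ k, θ k * (sol w q x u v k).1 ≤ C * (sol w q x 1 0 k).1) ∧
      ∀ k, 1 ≤ k → c * (sol w q x 1 0 k).1 ≤ (1 + x) * (θ k * (sol w q x u v k).1)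

theorem comparable_first (h : RegularString w q) : Comparable w q (fun _ => 1) 1 0 := by
  refine ⟨1, 1, one_pos, fun x hx => ⟨fun k => le_rfl, fun k _ => ?_⟩⟩
  have := (sol_nonneg h (by linarith : 0 ≤ x) zero_le_one (le_refl (0 : ℝ)) k).1
  nlinarith

/-- After one step the starts `(0, 1)` and `(1, 0)` become `(q 0, 1)` and `(1 + q 0 * x * w 0, x * w
0)`. These are comparable up to a factor linear in `x`, and monotonicity propagates the comparison.
At `k = 0` the displacement is 0, so the lower comparison starts at 1. -/
theorem comparable_second (h : RegularString w q) : Comparable w q (fun _ => 1) 0 1 := by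
  have hw := h.w_pos 0
  have hq := h.q_pos 0
  refine ⟨(1 / q 0 + w 0)⁻¹, q 0 + 1 / w 0, by positivity, fun x hx => ⟨fun k => ?_, fun k hk => ?_⟩⟩
  · have hx0 : 0 ≤ x := by linarith
    rw [one_mul]
    rcases Nat.eq_zero_or_pos k with rfl | hk
    · simp only [sol_zero]
      positivity
    · have e1 : (1 : ℝ) ≤ (q 0 + 1 / w 0) * (x * w 0) := by
        have : (q 0 + 1 / w 0) * (x * w 0) = q 0 * x * w 0 + x := by field_simp
        rw [this]
        have : 0 ≤ q 0 * x * w 0 := by positivity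
        linarith
      refine (sol_le_of_le h hx0 (k := 1) ?_ ?_ hk).1
      · simp only [sol]
        have : 0 ≤ (q 0 + 1 / w 0) * (q 0 * (x * w 0)) := by positivity
        have : 0 < 1 / w 0 := by positivity
        nlinarith
      · simp only [sol]
        linarith
  · have hx0 : 0 ≤ x := by linarith
    rw [one_mul, inv_mul_le_iff₀ (by positivity), ← mul_assoc]
    refine (sol_le_of_le h hx0 (k := 1) ?_ ?_ hk).1
    · simp only [sol]
      have : (1 / q 0 + w 0) * (1 + x) * q 0 = (1 + q 0 * (x * w 0)) + (x + w 0 * q 0) := by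
        field_simp; ring
      have : 0 ≤ x + w 0 * q 0 := by positivity
      simp only [zero_add, mul_zero, add_zero, mul_one]
      linarith
    · simp only [sol]
      have : 0 ≤ 1 / q 0 * (1 + x) := by positivity
      simp only [zero_add, mul_zero, add_zero, mul_one]
      nlinarith

/-- For `k ≥ 1` the new weight lies between `q 0` and the total length. -/
theorem Comparable.sum_weight (h : RegularString w q) (hu : 0 ≤ u) (hv : 0 ≤ v)
    (hc : Comparable w q (fun _ => 1) u v) :
    Comparable w q (fun k => ∑ i ∈ Finset.range k, q i) u v := by
  obtain ⟨c, C, hc0, hcC⟩ := hc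
  refine ⟨q 0 * c, (∑' i, q i) * C, mul_pos (h.q_pos 0) hc0, fun x hx => ⟨fun k => ?_,
    fun k hk => ?_⟩⟩
  · have h1 := (hcC x hx).1 k
    have h2 := (sol_nonneg h (by linarith : 0 ≤ x) hu hv k).1
    rw [one_mul] at h1
    have hs := h.q_summable.sum_le_tsum (Finset.range k) fun i _ => (h.q_pos i).le
    have hQ : 0 ≤ ∑' i, q i := tsum_nonneg fun i => (h.q_pos i).le
    rw [mul_assoc]
    exact mul_le_mul hs h1 h2 hQ
  · have h1 := (hcC x hx).2 k hk
    have h2 := (sol_nonneg h (by linarith : 0 ≤ x) hu hv k).1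
    rw [one_mul] at h1
    have hs : q 0 ≤ ∑ i ∈ Finset.range k, q i :=
      Finset.single_le_sum (f := q) (fun i _ => (h.q_pos i).le) (Finset.mem_range.2 hk)
    calc q 0 * c * (sol w q x 1 0 k).1 = q 0 * (c * (sol w q x 1 0 k).1) := by ring
      _ ≤ q 0 * ((1 + x) * (sol w q x u v k).1) := by gcongr; exact (h.q_pos 0).le
      _ = (1 + x) * (q 0 * (sol w q x u v k).1) := by ring
      _ ≤ _ := by gcongr

/-- Termwise summation; the subtracted `x * w 0` is the term `k = 0` of the flux, for which no lower
comparison is available. -/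
theorem Comparable.flux_bounds (h : RegularString w q) {Θ : ℝ} (hu : 0 ≤ u) (hv : 0 ≤ v)
    (hθ : ∀ k, 0 ≤ θ k) (hΘ : ∀ k, θ k ≤ Θ) (hc : Comparable w q θ u v) :
    ∃ c C : ℝ, 0 < c ∧ ∀ x : ℝ, 1 ≤ x →
      x * (∑' k, θ k * w k * (sol w q x u v k).1) ≤ C * flux w q x ∧
      c * (flux w q x - x * w 0) ≤ (1 + x) * (x * ∑' k, θ k * w k * (sol w q x u v k).1) := by
  obtain ⟨c, C, hc0, hcC⟩ := hc
  refine ⟨c, C, hc0, fun x hx => ?_⟩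
  have hx0 : 0 ≤ x := by linarith
  have hs1 := summable_mul_sol h hx0 zero_le_one (le_refl (0 : ℝ))
  have hs2 := summable_weight_mul_sol h hx0 hu hv hθ hΘ
  constructor
  · rw [flux, mul_left_comm, ← tsum_mul_left (a := C)]
    refine mul_le_mul_of_nonneg_left (Summable.tsum_le_tsum (fun k => ?_) hs2 (hs1.mul_left C)) hx0
    have := mul_le_mul_of_nonneg_left ((hcC x hx).1 k) (h.w_pos k).le
    linarith
  · have e : flux w q x - x * w 0 = x * ∑' k, w (k + 1) * (sol w q x 1 0 (k + 1)).1 := by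
      rw [flux, hs1.tsum_eq_zero_add, sol_zero]; ring
    rw [e, mul_left_comm, mul_left_comm (1 + x), ← tsum_mul_left (a := c),
      ← tsum_mul_left (a := 1 + x)]
    refine mul_le_mul_of_nonneg_left ?_ hx0
    rw [(hs2.mul_left (1 + x)).tsum_eq_zero_add]
    have h0 : 0 ≤ (1 + x) * (θ 0 * w 0 * (sol w q x u v 0).1) :=
      mul_nonneg (by linarith) (mul_nonneg (mul_nonneg (hθ 0) (h.w_pos 0).le)
        (sol_nonneg h hx0 hu hv 0).1)
    refine le_trans ?_ (le_add_of_nonneg_left h0)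
    refine Summable.tsum_le_tsum (fun k => ?_) (((summable_nat_add_iff 1).2 hs1).mul_left c)
      ((summable_nat_add_iff 1).2 (hs2.mul_left (1 + x)))
    have := mul_le_mul_of_nonneg_left ((hcC x hx).2 (k + 1) (by omega)) (h.w_pos (k + 1)).le
    linarith

/-- The maximum modulus agrees with the flux up to a factor `r ^ 2`. -/
theorem eventually_maxModulus_bounds (h : RegularString w q) {Θ : ℝ} (hu : 0 ≤ u) (hv : 0 ≤ v)
    (hθ : ∀ k, 0 ≤ θ k) (hΘ : ∀ k, θ k ≤ Θ) (hcmp : Comparable w q θ u v)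
    (hgrow : ∀ᶠ r : ℝ in atTop, r ^ 3 ≤ flux w q r) {c σ : ℂ} (hc : ‖c‖ ≤ 1)
    (hσ : ‖σ‖ = 1) {f : ℂ → ℂ} (hf : ∀ z, f z = c + σ * (z * series w q θ u v (-z))) :
    ∀ᶠ r : ℝ in atTop, flux w q r / r ^ 2 ≤ maxModulus f r ∧
      maxModulus f r ≤ r ^ 2 * flux w q r := by
  obtain ⟨a, C, ha, hb⟩ := hcmp.flux_bounds h hu hv hθ hΘ
  filter_upwards [hgrow, eventually_ge_atTop (3 : ℝ), eventually_ge_atTop (C + 1),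
    eventually_ge_atTop (4 / a), eventually_ge_atTop (2 * w 0 + 4 / a)] with r h1 h2 h3 h4 h5
  obtain ⟨b1, b2⟩ := hb r (by linarith)
  obtain ⟨m1, m2⟩ := maxModulus_le_and_le h (by linarith : 0 ≤ r) hu hv hθ hΘ hc hσ hf
  have hr : 0 < r := by linarith
  have hF1 : 1 ≤ flux w q r := le_trans (one_le_pow₀ (by linarith)) h1
  set F := flux w q r
  set G := r * ∑' k, θ k * w k * (sol w q r u v k).1
  constructor
  · refine le_trans ?_ m2
    have e1 : a * r ≥ 4 := by
      have := (div_le_iff₀ ha).1 h4; linarith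
    have e2 : r * (2 * w 0 + 4 / a) ≤ r ^ 2 := by nlinarith
    have e3 : r ^ 2 * r ≤ F := by nlinarith
    have hd : F / r ^ 2 * r ^ 2 = F := by field_simp
    set D := F / r ^ 2
    have hDr : r ≤ D := by
      rw [show D = F / r ^ 2 from rfl, le_div_iff₀ (by positivity)]; nlinarith
    -- Since `D ≥ r ≥ 3`, the left side is at most `2 r D`. From `a r ≥ 4` follows `a F ≥ 4 r D`,
    -- and `r * w 0` takes away at most half of `F`.
    have hkey : (1 + r) * (D + 1) ≤ a * (F - r * w 0) := by
      have hw := h.w_pos 0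
      have k1 : (1 + r) * (D + 1) ≤ 2 * r * D := by
        have := mul_le_mul_of_nonneg_right h2 (by linarith : 0 ≤ D)
        linarith
      have k2 : 4 * (r * D) ≤ a * F := by
        rw [← hd]; nlinarith [mul_pos hr (by linarith : 0 < D)]
      have k3 : 2 * (r * w 0) ≤ F := by
        have : 0 < 4 / a := by positivity
        nlinarith
      nlinarith
    have : (1 + r) * (D + 1) ≤ (1 + r) * G := hkey.trans b2
    have := le_of_mul_le_mul_left this (by linarith)
    linarith
  · have k1 := mul_le_mul_of_nonneg_right h3 (by linarith : 0 ≤ F)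
    have k2 : r * F ≤ r ^ 2 * F := by gcongr; nlinarith
    linarith

end Comparison

theorem limsup_coe_eq_of_tendsto_sub {α : Type*} {l : Filter α} [l.NeBot] {f g : α → ℝ}
    (h : Tendsto (fun x => f x - g x) l (𝓝 0)) :
    limsup (fun x => (f x : EReal)) l = limsup (fun x => (g x : EReal)) l := by
  have key : ∀ f g : α → ℝ, Tendsto (fun x => f x - g x) l (𝓝 0) →
      limsup (fun x => (f x : EReal)) l ≤ limsup (fun x => (g x : EReal)) l := by
    intro f g h
    have h0 : limsup (fun x => ((f x - g x : ℝ) : EReal)) l = 0 :=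
      ((continuous_coe_real_ereal.tendsto 0).comp h).limsup_eq
    have := EReal.limsup_add_le (f := l) (u := fun x => (g x : EReal))
      (v := fun x => ((f x - g x : ℝ) : EReal)) (Or.inr (by rw [h0]; exact EReal.zero_ne_top))
      (Or.inr (by rw [h0]; exact EReal.zero_ne_bot))
    rw [h0, add_zero] at this
    refine le_trans (le_of_eq ?_) this
    congr 1
    ext x
    rw [Pi.add_apply, ← EReal.coe_add]
    congr 1
    ring
  refine le_antisymm (key f g h) (key g f ?_)
  have := h.neg
  simpa using this

theorem tendsto_log_div_rpow {s : ℝ} (hs : 0 < s) :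
    Tendsto (fun r : ℝ => Real.log r / r ^ s) atTop (𝓝 0) :=
  (isLittleO_log_rpow_atTop hs).tendsto_div_nhds_zero

/-- A function comparable with a gauge `V` of exponential size `r ^ ρ` has order `ρ`, and its type
is determined by `V`. -/
theorem hasType_of_gauge {V : ℝ → ℝ} {ρ lo hi C₁ C₂ : ℝ} (hρ : 0 < ρ) (hlo : 0 < lo)
    (hV1 : ∀ᶠ r : ℝ in atTop, lo * r ^ ρ - C₁ * (1 + Real.log r) ≤ Real.log (V r))
    (hV2 : ∀ᶠ r : ℝ in atTop, Real.log (V r) ≤ hi * r ^ ρ + C₂ * (1 + Real.log r))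
    (hV0 : ∀ᶠ r : ℝ in atTop, 0 < V r) {f : ℂ → ℂ} (hf : Differentiable ℂ f)
    (hM : ∀ᶠ r : ℝ in atTop, V r / r ^ 2 ≤ maxModulus f r ∧ maxModulus f r ≤ r ^ 2 * V r) :
    HasType f ρ (limsup (fun r : ℝ => ((Real.log (V r) / r ^ ρ : ℝ) : EReal)) atTop) := by
  have hlog0 := tendsto_log_div_rpow hρ
  have hpow := tendsto_rpow_atTop hρ
  have hinv : Tendsto (fun r : ℝ => 1 / r ^ ρ) atTop (𝓝 0) := by
    exact hpow.inv_tendsto_atTop.congr fun r => by simp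
  have hdiff : ∀ᶠ r : ℝ in atTop,
      |Real.log (maxModulus f r) - Real.log (V r)| ≤ 2 * Real.log r := by
    filter_upwards [hM, hV0, eventually_gt_atTop 1] with r hr hv h1
    have hr0 : 0 < r := by linarith
    have hd : 0 < V r / r ^ 2 := by positivity
    have e1 := Real.log_le_log hd hr.1
    have e2 := Real.log_le_log (hd.trans_le hr.1) hr.2
    rw [Real.log_div hv.ne' (by positivity), Real.log_pow] at e1
    rw [Real.log_mul (by positivity) hv.ne', Real.log_pow] at e2
    push_cast at e1 e2
    rw [abs_le]
    constructor <;> linarith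
  have hdz : Tendsto (fun r : ℝ => Real.log (maxModulus f r) / r ^ ρ - Real.log (V r) / r ^ ρ)
      atTop (𝓝 0) := by
    have h2 : Tendsto (fun r : ℝ => 2 * (Real.log r / r ^ ρ)) atTop (𝓝 0) := by
      simpa using hlog0.const_mul 2
    refine squeeze_zero_norm' ?_ h2
    filter_upwards [hdiff, eventually_gt_atTop 0] with r hr h0
    have : 0 < r ^ ρ := Real.rpow_pos_of_pos h0 _
    rw [← sub_div, norm_div, Real.norm_eq_abs, Real.norm_of_nonneg this.le, ← mul_div_assoc]
    gcongr
  refine ⟨⟨hf, ?_⟩, limsup_coe_eq_of_tendsto_sub hdz⟩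
  have hsmall : Tendsto (fun r : ℝ => (|C₁| + |C₂| + 2) * (1 / r ^ ρ + Real.log r / r ^ ρ)) atTop
      (𝓝 0) := by
    simpa using (hinv.add hlog0).const_mul (|C₁| + |C₂| + 2)
  -- Crude two-sided bounds suffice for the order, because constant factors disappear in `log log M
  -- / log r`.
  have hbounds : ∀ᶠ r : ℝ in atTop, lo / 2 * r ^ ρ ≤ Real.log (maxModulus f r) ∧
      Real.log (maxModulus f r) ≤ (|hi| + lo) * r ^ ρ := by
    filter_upwards [hdiff, hV1, hV2, eventually_gt_atTop 1,
      hsmall.eventually_le_const (show 0 < lo / 2 by positivity)] with r h1 h2 h3 h4 h5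
    have hl : 0 < Real.log r := Real.log_pos h4
    have hp : 0 < r ^ ρ := Real.rpow_pos_of_pos (by linarith) _
    rw [← add_div, ← mul_div_assoc, div_le_iff₀ hp] at h5
    have a1 := le_abs_self C₁
    have a2 := le_abs_self C₂
    have a3 := mul_le_mul_of_nonneg_right (le_abs_self hi) hp.le
    have b1 := abs_nonneg C₁
    have b2 := abs_nonneg C₂
    have c1 : C₁ * (1 + Real.log r) ≤ |C₁| * (1 + Real.log r) := by gcongr
    have c2 : C₂ * (1 + Real.log r) ≤ |C₂| * (1 + Real.log r) := by gcongr
    have d1 : 0 ≤ |C₁| * (1 + Real.log r) := by positivity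
    have d2 : 0 ≤ |C₂| * (1 + Real.log r) := by positivity
    rw [abs_le] at h1
    have e : lo * r ^ ρ = 2 * (lo / 2 * r ^ ρ) := by ring
    constructor
    · nlinarith
    · nlinarith
  have hK : 0 < |hi| + lo := by positivity
  have hlim : Tendsto (fun r : ℝ => Real.log (Real.log (maxModulus f r)) / Real.log r) atTop
      (𝓝 ρ) := by
    have hli : Tendsto (fun r : ℝ => 1 / Real.log r) atTop (𝓝 0) := by
      exact Real.tendsto_log_atTop.inv_tendsto_atTop.congr fun r => by simp
    have t1 : Tendsto (fun r : ℝ => Real.log (lo / 2) * (1 / Real.log r) + ρ) atTop (𝓝 ρ) := by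
      simpa using (hli.const_mul (Real.log (lo / 2))).add_const ρ
    have t2 : Tendsto (fun r : ℝ => Real.log (|hi| + lo) * (1 / Real.log r) + ρ) atTop (𝓝 ρ) := by
      simpa using (hli.const_mul (Real.log (|hi| + lo))).add_const ρ
    have hlin : ∀ k r : ℝ, 0 < k → 1 < r →
        Real.log k * (1 / Real.log r) + ρ = Real.log (k * r ^ ρ) / Real.log r := by
      intro k r hk hr
      have hl : 0 < Real.log r := Real.log_pos hr
      rw [Real.log_mul hk.ne' (Real.rpow_pos_of_pos (by linarith) _).ne',
        Real.log_rpow (by linarith)]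
      field_simp
    refine tendsto_of_tendsto_of_tendsto_of_le_of_le' t1 t2 ?_ ?_
    · filter_upwards [hbounds, eventually_gt_atTop 1] with r h1 h2
      have hl : 0 < Real.log r := Real.log_pos h2
      have hp : 0 < r ^ ρ := Real.rpow_pos_of_pos (by linarith) _
      rw [hlin _ _ (by positivity) h2]
      gcongr
      exact h1.1
    · filter_upwards [hbounds, eventually_gt_atTop 1] with r h1 h2
      have hl : 0 < Real.log r := Real.log_pos h2
      have hp : 0 < r ^ ρ := Real.rpow_pos_of_pos (by linarith) _
      have h3 : 0 < Real.log (maxModulus f r) := lt_of_lt_of_le (by positivity) h1.1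
      rw [hlin _ _ hK h2]
      gcongr
      exact h1.2
  exact ((continuous_coe_real_ereal.tendsto ρ).comp hlim).limsup_eq

theorem limsup_gauge_mem {V : ℝ → ℝ} {ρ lo hi C₁ C₂ : ℝ} (hρ : 0 < ρ)
    (hV1 : ∀ᶠ r : ℝ in atTop, lo * r ^ ρ - C₁ * (1 + Real.log r) ≤ Real.log (V r))
    (hV2 : ∀ᶠ r : ℝ in atTop, Real.log (V r) ≤ hi * r ^ ρ + C₂ * (1 + Real.log r)) :
    (lo : EReal) ≤ limsup (fun r : ℝ => ((Real.log (V r) / r ^ ρ : ℝ) : EReal)) atTop ∧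
      limsup (fun r : ℝ => ((Real.log (V r) / r ^ ρ : ℝ) : EReal)) atTop ≤ (hi : EReal) := by
  have hlog0 := tendsto_log_div_rpow hρ
  have hinv : Tendsto (fun r : ℝ => 1 / r ^ ρ) atTop (𝓝 0) := by
    exact (tendsto_rpow_atTop hρ).inv_tendsto_atTop.congr fun r => by simp
  have t1 : Tendsto (fun r : ℝ => lo - C₁ * (1 / r ^ ρ + Real.log r / r ^ ρ)) atTop (𝓝 lo) := by
    simpa using ((hinv.add hlog0).const_mul C₁).const_sub lo
  have t2 : Tendsto (fun r : ℝ => hi + C₂ * (1 / r ^ ρ + Real.log r / r ^ ρ)) atTop (𝓝 hi) := by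
    simpa using ((hinv.add hlog0).const_mul C₂).const_add hi
  constructor
  · rw [← ((continuous_coe_real_ereal.tendsto lo).comp t1).limsup_eq]
    refine limsup_le_limsup ?_
    filter_upwards [hV1, eventually_gt_atTop 0] with r h1 h2
    have hp : 0 < r ^ ρ := Real.rpow_pos_of_pos h2 _
    refine EReal.coe_le_coe_iff.2 ?_
    rw [le_div_iff₀ hp]
    refine le_trans (le_of_eq ?_) h1
    field_simp
  · rw [← ((continuous_coe_real_ereal.tendsto hi).comp t2).limsup_eq]
    refine limsup_le_limsup ?_
    filter_upwards [hV2, eventually_gt_atTop 0] with r h1 h2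
    have hp : 0 < r ^ ρ := Real.rpow_pos_of_pos h2 _
    refine EReal.coe_le_coe_iff.2 ?_
    rw [div_le_iff₀ hp]
    refine h1.trans (le_of_eq ?_)
    field_simp

end

/-! ### Raabe's test, admissible parameters and the type bounds. -/

section

open Topology

/-- A form of Raabe's test that also yields a convergent series with a power weight. -/
theorem exists_summable_rpow_mul {c : ℕ → ℝ} (hc : ∀ n, 0 < c n) {a : ℝ} (ha : 1 < a)
    (hlim : Tendsto (fun n : ℕ => (n : ℝ) * (Real.log (c n) - Real.log (c (n + 1)))) atTop (𝓝 a)) :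
    ∃ δ : ℝ, 0 < δ ∧ Summable fun n : ℕ => ((n : ℝ) + 1) ^ δ * c n := by
  -- With `1 < s < a`, the sequence is eventually at most a constant times `(n + 1)^(-s)`. The
  -- weight exponent `(a - 1) / 4` used below keeps the total exponent at `-(a + 3) / 4 < -1`.
  set s := (1 + a) / 2 with hs
  have hs0 : 0 ≤ s := by linarith
  have hsa : s < a := by linarith
  obtain ⟨N, hN⟩ := eventually_atTop.1 ((hlim.eventually (lt_mem_nhds hsa)).and
    (eventually_ge_atTop 1))
  set G := Real.log (c N) + s * Real.log (N + 1) with hG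
  have hg : ∀ n : ℕ, N ≤ n → Real.log (c n) + s * Real.log (n + 1) ≤ G := by
    intro n hn
    induction n, hn using Nat.le_induction with
    | base => exact le_rfl
    | succ n hn ih =>
      obtain ⟨h1, h2⟩ := hN n hn
      have hn0 : (0 : ℝ) < n := by exact_mod_cast h2
      have h3 : Real.log ((n : ℝ) + 1 + 1) - Real.log ((n : ℝ) + 1) ≤ 1 / n := by
        rw [← Real.log_div (by positivity) (by positivity)]
        refine (Real.log_le_sub_one_of_pos (by positivity)).trans ?_
        rw [div_sub_one (by positivity), add_sub_cancel_left]
        gcongr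
        linarith
      have h4 : s * (1 / n) ≤ Real.log (c n) - Real.log (c (n + 1)) := by
        rw [mul_one_div, div_le_iff₀ hn0]; linarith
      have h5 := mul_le_mul_of_nonneg_left h3 hs0
      push_cast
      linarith
  refine ⟨(a - 1) / 4, by linarith, ?_⟩
  have hsum : Summable fun n : ℕ => Real.exp G * ((n + 1 : ℕ) : ℝ) ^ ((a - 1) / 4 - s) :=
    ((summable_nat_add_iff 1).2 (Real.summable_nat_rpow.2 (by linarith))).mul_left _
  refine Summable.of_norm_bounded_eventually_nat hsum ?_
  filter_upwards [eventually_ge_atTop N] with n hn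
  have hn1 : (0 : ℝ) < (n : ℝ) + 1 := by positivity
  have h1 : c n ≤ Real.exp G * ((n : ℝ) + 1) ^ (-s) := by
    rw [← Real.log_le_log_iff (hc n) (by positivity), Real.log_mul (by positivity) (by positivity),
      Real.log_exp, Real.log_rpow hn1]
    linarith [hg n hn]
  rw [Real.norm_of_nonneg (mul_nonneg (by positivity) (hc n).le), Nat.cast_succ,
    sub_eq_add_neg _ s, Real.rpow_add hn1]
  calc _ ≤ ((n : ℝ) + 1) ^ ((a - 1) / 4) * (Real.exp G * ((n : ℝ) + 1) ^ (-s)) := by gcongr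
    _ = _ := by ring

theorem summable_of_summable_rpow_mul {c : ℕ → ℝ} (hc : ∀ n, 0 < c n)
    (h : ∃ δ : ℝ, 0 < δ ∧ Summable fun n : ℕ => ((n : ℝ) + 1) ^ δ * c n) : Summable c := by
  obtain ⟨δ, hδ, hs⟩ := h
  refine Summable.of_nonneg_of_le (fun n => (hc n).le) (fun n => ?_) hs
  exact le_mul_of_one_le_left (hc n).le
    (Real.one_le_rpow (by linarith [Nat.cast_nonneg (α := ℝ) n]) hδ.le)

theorem tendsto_mul_log_add_sub {p : ℝ} (hp : 0 < p) (α : ℝ) :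
    Tendsto (fun n : ℕ => (n : ℝ) * (Real.log (p * n + α) - Real.log (p * n))) atTop
      (𝓝 (α / p)) := by
  have h := (Real.tendsto_mul_log_one_add_div_atTop (α / p)).comp
    (tendsto_natCast_atTop_atTop (R := ℝ))
  refine h.congr' ?_
  have hlarge : ∀ᶠ n : ℕ in atTop, |α| / p < (n : ℝ) :=
    tendsto_natCast_atTop_atTop.eventually_gt_atTop _
  filter_upwards [eventually_gt_atTop 0, hlarge] with n hn hn2
  have hn0 : (0 : ℝ) < n := by exact_mod_cast hn
  have hpos : 0 < p * n + α := by
    have := (div_lt_iff₀ hp).1 hn2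
    have := neg_abs_le α
    linarith
  simp only [Function.comp]
  rw [← Real.log_div hpos.ne' (by positivity)]
  congr 2
  field_simp

theorem tendsto_mul_log_rate {p : ℕ} (hp : 0 < p) {x : Fin p → ℝ}
    (hx : ∀ (n : ℕ) j, 0 < (p : ℝ) * n + x j) :
    Tendsto (fun n : ℕ => (n : ℝ) * (Real.log (rate p x n) - p * Real.log (p * n))) atTop
      (𝓝 ((∑ j, x j) / p)) := by
  have hp0 : (0 : ℝ) < p := by exact_mod_cast hp
  have h := tendsto_finsetSum (Finset.univ : Finset (Fin p))
    fun j _ => tendsto_mul_log_add_sub hp0 (x j)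
  rw [Finset.sum_div]
  refine h.congr fun n => ?_
  rw [rate, Real.log_prod fun j _ => (hx n j).ne', ← Finset.mul_sum, Finset.sum_sub_distrib]
  simp

/-- The shifted death rates have parameters `d j + p`, which are positive even where `d j` is not.
-/
theorem rate_succ (p : ℕ) (x : Fin p → ℝ) (n : ℕ) :
    rate p x (n + 1) = rate p (fun j => x j + p) n := by
  unfold rate
  congr 1
  ext j
  push_cast
  ring

section Admissible

variable {p : ℕ} {e d : Fin p → ℝ}

theorem Admissible.three_le (h : Admissible p e d) : 3 ≤ p := by
  have h1 := h.indet_left.trans h.indet_right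
  have : (2 : ℝ) < p := by linarith
  exact_mod_cast this

theorem Admissible.birth_factor_pos (h : Admissible p e d) (n : ℕ) (j : Fin p) :
    0 < (p : ℝ) * n + e j := by
  have := h.e_pos j
  positivity

theorem Admissible.death_factor_pos (h : Admissible p e d) (n : ℕ) (j : Fin p) :
    0 < (p : ℝ) * n + (d j + p) := by
  have h1 := h.d_gt j
  have : 0 ≤ (p : ℝ) * n := by positivity
  linarith

theorem Admissible.birth_pos (h : Admissible p e d) (n : ℕ) : 0 < rate p e n :=
  Finset.prod_pos fun j _ => h.birth_factor_pos n j

theorem Admissible.death_pos (h : Admissible p e d) (n : ℕ) : 0 < rate p d (n + 1) := by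
  rw [rate_succ]
  exact Finset.prod_pos fun j _ => h.death_factor_pos n j

theorem Admissible.death_zero (h : Admissible p e d) : rate p d 0 = 0 := by
  simpa [rate] using h.d_prod

theorem len_pos {lam mu : ℕ → ℝ} (hl : ∀ n, 0 < lam n) (hm : ∀ n, 0 < mu (n + 1)) (n : ℕ) :
    0 < len lam mu n := one_div_pos.2 (mul_pos (hl n) (mass_pos hl hm n))

theorem log_mass_sub {lam mu : ℕ → ℝ} (hl : ∀ n, 0 < lam n) (hm : ∀ n, 0 < mu (n + 1)) (n : ℕ) :
    Real.log (mass lam mu n) - Real.log (mass lam mu (n + 1)) =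
      Real.log (mu (n + 1)) - Real.log (lam n) := by
  rw [mass_succ, Real.log_mul (mass_pos hl hm n).ne' (div_pos (hl n) (hm n)).ne',
    Real.log_div (hl n).ne' (hm n).ne']
  ring

theorem log_len_sub {lam mu : ℕ → ℝ} (hl : ∀ n, 0 < lam n) (hm : ∀ n, 0 < mu (n + 1)) (n : ℕ) :
    Real.log (len lam mu n) - Real.log (len lam mu (n + 1)) =
      Real.log (lam (n + 1)) - Real.log (mu (n + 1)) := by
  have h := log_mass_sub hl hm n
  rw [len, len, one_div, one_div, Real.log_inv, Real.log_inv,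
    Real.log_mul (hl n).ne' (mass_pos hl hm n).ne',
    Real.log_mul (hl (n + 1)).ne' (mass_pos hl hm (n + 1)).ne']
  linarith

theorem exists_abs_le_div_succ {x : ℕ → ℝ} {a : ℝ}
    (h : Tendsto (fun n : ℕ => (n : ℝ) * x n) atTop (𝓝 a)) :
    ∃ K : ℝ, 0 ≤ K ∧ ∀ n : ℕ, |x n| ≤ K / (n + 1) := by
  obtain ⟨B, hB⟩ := (Metric.isBounded_range_of_tendsto _ h).exists_norm_le
  have hB' : ∀ n : ℕ, (n : ℝ) * |x n| ≤ B := fun n => by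
    have := hB _ ⟨n, rfl⟩
    rwa [Real.norm_eq_abs, abs_mul, Nat.abs_cast] at this
  have hB0 : 0 ≤ B := le_trans (by positivity) (hB' 0)
  refine ⟨2 * B + |x 0|, by positivity, fun n => ?_⟩
  rw [le_div_iff₀ (by positivity)]
  rcases Nat.eq_zero_or_pos n with rfl | hn
  · simp; linarith
  · have h1 : (1 : ℝ) ≤ n := by exact_mod_cast hn
    have := hB' n
    nlinarith [abs_nonneg (x n), abs_nonneg (x 0)]

/-- The Raabe limits of masses and lengths are `p - (E - D) / p` and `(E - D) / p`; the two
indeterminacy inequalities say exactly that both exceed 1. Their existence also controls the ratios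
of `√(q n / w n)`, and `w n * q n = 1 / λ_n` gives the power bounds. -/
theorem Admissible.powerString (h : Admissible p e d) :
    PowerString p (mass (rate p e) (rate p d)) (len (rate p e) (rate p d)) := by
  have hp := h.three_le
  have hp0 : (0 : ℝ) < p := by exact_mod_cast (by omega : 0 < p)
  have hl := h.birth_pos
  have hm := h.death_pos
  set w := mass (rate p e) (rate p d) with hw
  set q := len (rate p e) (rate p d) with hq
  have hw0 : ∀ n, 0 < w n := mass_pos hl hm
  have hq0 : ∀ n, 0 < q n := len_pos hl hm
  have L1 := tendsto_mul_log_rate (by omega) h.birth_factor_pos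
  have L2 := tendsto_mul_log_rate (by omega) h.death_factor_pos
  have L3 := tendsto_mul_log_rate (x := fun j => e j + p) (by omega) fun n j => by
    have := h.birth_factor_pos n j
    linarith
  simp only [← rate_succ] at L2 L3
  have hsumD : (∑ j, (d j + p)) / p = (∑ j, d j) / p + p := by
    rw [Finset.sum_add_distrib]; simp; field_simp
  have hsumE : (∑ j, (e j + p)) / p = (∑ j, e j) / p + p := by
    rw [Finset.sum_add_distrib]; simp; field_simp
  have hr := h.indet_right
  have hle := h.indet_left
  rw [sub_div] at hr hle
  have Lw : Tendsto (fun n : ℕ => (n : ℝ) * (Real.log (w n) - Real.log (w (n + 1)))) atTop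
      (𝓝 ((∑ j, d j) / p + p - (∑ j, e j) / p)) := by
    rw [← hsumD]
    refine (L2.sub L1).congr fun n => ?_
    rw [log_mass_sub hl hm]
    ring
  have Lq : Tendsto (fun n : ℕ => (n : ℝ) * (Real.log (q n) - Real.log (q (n + 1)))) atTop
      (𝓝 ((∑ j, e j) / p + p - ((∑ j, d j) / p + p))) := by
    rw [← hsumD, ← hsumE]
    refine (L3.sub L2).congr fun n => ?_
    rw [log_len_sub hl hm]
    ring
  have tw := exists_summable_rpow_mul hw0 (by linarith) Lw
  have tq := exists_summable_rpow_mul hq0 (by linarith) Lq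
  have hwq : ∀ n, w n * q n = (rate p e n)⁻¹ := fun n => by
    have h1 := hl n
    have h2 := mass_pos hl hm n
    rw [hw, hq, len]
    field_simp
  refine ⟨⟨hw0, hq0, summable_of_summable_rpow_mul hw0 tw, summable_of_summable_rpow_mul hq0 tq⟩,
    ?_, tw, fun n => ?_, ?_⟩
  · have Lt := (Lq.sub Lw).div_const 2
    obtain ⟨K, hK, hKn⟩ := exists_abs_le_div_succ
      (x := fun n => ((Real.log (q n) - Real.log (q (n + 1))) -
        (Real.log (w n) - Real.log (w (n + 1)))) / 2) (Lt.congr fun n => by ring)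
    have hlog : ∀ n, Real.log √(q n / w n) = (Real.log (q n) - Real.log (w n)) / 2 := fun n => by
      rw [Real.log_sqrt (div_pos (hq0 n) (hw0 n)).le, Real.log_div (hq0 n).ne' (hw0 n).ne']
    have hpos : ∀ n, 0 < √(q n / w n) := fun n => Real.sqrt_pos.2 (div_pos (hq0 n) (hw0 n))
    refine ⟨K, hK, fun n => ?_⟩
    have := abs_le.1 (hKn n)
    constructor
    · rw [← Real.log_le_log_iff (hpos _) (mul_pos (Real.exp_pos _) (hpos _)),
        Real.log_mul (Real.exp_pos _).ne' (hpos _).ne', Real.log_exp, hlog, hlog]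
      linarith [this.1]
    · rw [← Real.log_le_log_iff (hpos _) (mul_pos (Real.exp_pos _) (hpos _)),
        Real.log_mul (Real.exp_pos _).ne' (hpos _).ne', Real.log_exp, hlog, hlog]
      linarith [this.2]
  · rw [hwq, mul_inv_le_iff₀ (hl n), one_mul, rate]
    calc ((p : ℝ) * n) ^ p = ∏ _j : Fin p, ((p : ℝ) * n) := by simp
      _ ≤ _ := Finset.prod_le_prod (fun j _ => by positivity) fun j _ => by
        linarith [h.e_pos j]
  -- Since `e j ≤ E ≤ k ≤ p * k`, every factor of `λ_n` is at most `p (k + n)`.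
  · refine ⟨⌈∑ j, e j⌉₊ + 1, by omega, fun n => ?_⟩
    rw [hwq, le_mul_inv_iff₀ (hl n), one_mul, rate]
    calc _ ≤ ∏ _j : Fin p, ((p : ℝ) * (((⌈∑ j, e j⌉₊ + 1 : ℕ) : ℝ) + n)) := by
          refine Finset.prod_le_prod (fun j _ => (h.birth_factor_pos n j).le) fun j _ => ?_
          have h1 : e j ≤ ∑ j, e j :=
            Finset.single_le_sum (f := e) (fun i _ => (h.e_pos i).le) (Finset.mem_univ j)
          have h2 := Nat.le_ceil (∑ j, e j)
          have h3 : (1 : ℝ) ≤ p := by exact_mod_cast (by omega : 1 ≤ p)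
          have h4 : (0 : ℝ) ≤ (⌈∑ j, e j⌉₊ : ℝ) := Nat.cast_nonneg _
          push_cast
          nlinarith
      _ = _ := by simp

/-- The displacements are bounded in `n`, and their squares are weighted by the summable masses. -/
theorem isIndeterminate_of_regularString {lam mu : ℕ → ℝ} (hl : ∀ n, 0 < lam n)
    (hm : ∀ n, 0 < mu (n + 1)) (h0 : mu 0 = 0)
    (h : RegularString (mass lam mu) (len lam mu)) :
    IsIndeterminate (fun n => lam n + mu n) (fun n => √(lam n * mu (n + 1))) := by
  have key : ∀ (z : ℂ) (u v : ℝ), 0 ≤ u → 0 ≤ v → Summable fun n =>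
      ‖(-1) ^ n * (√(mass lam mu n) : ℂ) * csol (mass lam mu) (len lam mu) z u v n‖ ^ 2 := by
    intro z u v hu hv
    set B := (u + v) * Real.exp (‖z‖ * (∑' i, mass lam mu i) + ∑' i, len lam mu i)
    refine Summable.of_nonneg_of_le (fun n => sq_nonneg _) (fun n => ?_)
      (h.w_summable.mul_right (B ^ 2))
    have hB : ‖csol (mass lam mu) (len lam mu) z u v n‖ ≤ B :=
      (norm_csol_le h le_rfl hu hv n).trans (sol_fst_le h (norm_nonneg z) hu hv n)
    rw [norm_mul, norm_mul, norm_pow, norm_neg, norm_one, one_pow, one_mul, mul_pow,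
      Complex.norm_of_nonneg (Real.sqrt_nonneg _), Real.sq_sqrt (h.w_pos n).le]
    have := (h.w_pos n).le
    gcongr
  intro z
  constructor
  · simp only [P_eq hl hm h0]
    exact key (-z) 1 0 zero_le_one le_rfl
  · simp only [Q_eq hl hm, norm_neg]
    exact key (-z) 0 1 le_rfl zero_le_one

theorem PowerString.eventually_pow_three_le_flux {w q : ℕ → ℝ} (hp : 3 ≤ p)
    (h : PowerString p w q) : ∀ᶠ r : ℝ in atTop, r ^ 3 ≤ flux w q r := by
  obtain ⟨C, hC⟩ := h.le_log_flux hp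
  have hp0 : (0 : ℝ) < p := by exact_mod_cast (by omega : 0 < p)
  have hρ : 0 < 1 / (p : ℝ) := by positivity
  have hlo : 0 < lowerBound p := div_pos Real.pi_pos (mul_pos hp0 (sin_pi_div_pos hp))
  have h1 : Tendsto (fun r : ℝ => (|C| + 3) * (1 / r ^ (1 / (p : ℝ)) +
      Real.log r / r ^ (1 / (p : ℝ)))) atTop (𝓝 0) := by
    have hinv : Tendsto (fun r : ℝ => 1 / r ^ (1 / (p : ℝ))) atTop (𝓝 0) :=
      (tendsto_rpow_atTop hρ).inv_tendsto_atTop.congr fun r => by simp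
    simpa using (hinv.add (tendsto_log_div_rpow hρ)).const_mul (|C| + 3)
  filter_upwards [hC, h1.eventually_le_const hlo, eventually_gt_atTop 1] with r h2 h3 h4
  have hr : 0 < r := by linarith
  have hl : 0 < Real.log r := Real.log_pos h4
  have hf0 : 0 < flux w q r :=
    lt_of_lt_of_le (mul_pos hr (h.w_pos 0)) (mul_le_flux h.toRegularString hr.le)
  rw [← add_div, ← mul_div_assoc, div_le_iff₀ (Real.rpow_pos_of_pos hr _)] at h3
  rw [← Real.log_le_log_iff (by positivity) hf0, Real.log_pow]
  have := mul_le_mul_of_nonneg_right (le_abs_self C) (by linarith : 0 ≤ 1 + Real.log r)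
  push_cast
  linarith

/-- Indeterminacy, order and type of the moment problem, with the common type bounded. -/
theorem Admissible.exists_type (h : Admissible p e d) :
    ∃ τ : ℝ, lowerBound p ≤ τ ∧ τ ≤ upperBound p ∧
      IsIndeterminate (jacobiA p e d) (jacobiB p e d) ∧
      HasType (nevA (jacobiA p e d) (jacobiB p e d)) (1 / p) τ ∧
      HasType (nevB (jacobiA p e d) (jacobiB p e d)) (1 / p) τ ∧
      HasType (nevC (jacobiA p e d) (jacobiB p e d)) (1 / p) τ ∧
      HasType (nevD (jacobiA p e d) (jacobiB p e d)) (1 / p) τ := by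
  have hp := h.three_le
  have hp0 : (0 : ℝ) < p := by exact_mod_cast (by omega : 0 < p)
  have hρ : 0 < 1 / (p : ℝ) := by positivity
  have hlo : 0 < lowerBound p := div_pos Real.pi_pos (mul_pos hp0 (sin_pi_div_pos hp))
  have hl := h.birth_pos
  have hm := h.death_pos
  have h0 := h.death_zero
  have hs := h.powerString
  have hreg := hs.toRegularString
  have eA : jacobiA p e d = fun n => rate p e n + rate p d n := rfl
  have eB : jacobiB p e d = fun n => √(rate p e n * rate p d (n + 1)) := rfl
  rw [eA, eB]
  set w := mass (rate p e) (rate p d)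
  set q := len (rate p e) (rate p d)
  obtain ⟨C₁, hC₁⟩ := hs.le_log_flux hp
  obtain ⟨C₂, hC₂⟩ := hs.log_flux_le hp
  have hC₂' := (eventually_ge_atTop (1 : ℝ)).mono hC₂
  have hV0 : ∀ᶠ r : ℝ in atTop, 0 < flux w q r := by
    filter_upwards [eventually_gt_atTop 0] with r hr
    exact lt_of_lt_of_le (mul_pos hr (hs.w_pos 0)) (mul_le_flux hreg hr.le)
  obtain ⟨t1, t2⟩ := limsup_gauge_mem hρ hC₁ hC₂'
  set T := limsup (fun r : ℝ =>
    ((Real.log (flux w q r) / r ^ (1 / (p : ℝ)) : ℝ) : EReal)) atTop with hT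
  -- The common limsup `T` lies between two real numbers, hence is finite.
  have hcoe : ((T.toReal : ℝ) : EReal) = T := EReal.coe_toReal
    (ne_top_of_le_ne_top (EReal.coe_ne_top _) t2) (ne_bot_of_le_ne_bot (EReal.coe_ne_bot _) t1)
  have htype : ∀ (θ : ℕ → ℝ) (Θ u v : ℝ), 0 ≤ u → 0 ≤ v → (∀ k, 0 ≤ θ k) → (∀ k, θ k ≤ Θ) →
      Comparable w q θ u v → ∀ (c σ : ℂ), ‖c‖ ≤ 1 → ‖σ‖ = 1 → ∀ f : ℂ → ℂ,
      (∀ z, f z = c + σ * (z * series w q θ u v (-z))) →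
        HasType f (1 / p) ((T.toReal : ℝ) : EReal) := by
    intro θ Θ u v hu hv hθ hΘ hcmp c σ hc hσ f hf
    rw [hcoe]
    have hd : Differentiable ℂ f := by
      have := differentiable_series hreg hu hv hθ hΘ
      rw [show f = fun z => c + σ * (z * series w q θ u v (-z)) from funext hf]
      fun_prop
    exact hasType_of_gauge hρ hlo hC₁ hC₂' hV0 hd
      (eventually_maxModulus_bounds hreg hu hv hθ hΘ hcmp (hs.eventually_pow_three_le_flux hp)
        hc hσ hf)
  have hL0 : ∀ k, 0 ≤ ∑ i ∈ Finset.range k, q i :=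
    fun k => Finset.sum_nonneg fun i _ => (hs.q_pos i).le
  have hL1 : ∀ k, ∑ i ∈ Finset.range k, q i ≤ ∑' i, q i :=
    fun k => hs.q_summable.sum_le_tsum _ fun i _ => (hs.q_pos i).le
  refine ⟨T.toReal, ?_, ?_, isIndeterminate_of_regularString hl hm h0 hreg, ?_, ?_, ?_, ?_⟩
  · rw [← hcoe] at t1; exact_mod_cast t1
  · rw [← hcoe] at t2; exact_mod_cast t2
  · exact htype _ _ 0 1 le_rfl zero_le_one hL0 hL1
      ((comparable_second hreg).sum_weight hreg le_rfl zero_le_one) 0 1 (by simp) (by simp) _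
      (nevA_eq hl hm)
  · exact htype _ _ 1 0 zero_le_one le_rfl hL0 hL1
      ((comparable_first hreg).sum_weight hreg zero_le_one le_rfl) (-1) (-1) (by simp) (by simp) _
      (nevB_eq hl hm h0)
  · exact htype _ 1 0 1 le_rfl zero_le_one (fun _ => zero_le_one) (fun _ => le_rfl)
      (comparable_second hreg) 1 (-1) (by simp) (by simp) _ (nevC_eq hl hm h0)
  · exact htype _ 1 1 0 zero_le_one le_rfl (fun _ => zero_le_one) (fun _ => le_rfl)
      (comparable_first hreg) 0 1 (by simp) (by simp) _ (nevD_eq hl hm h0)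

/-- A limsup is unique, so the order and type supplied by the hypothesis coincide with those
constructed; comparing the entry `D` is enough. -/
theorem Admissible.type_mem (h : Admissible p e d) {τ : ℝ}
    (hτ : HasMomentType (jacobiA p e d) (jacobiB p e d) (τ : EReal)) :
    lowerBound p ≤ τ ∧ τ ≤ upperBound p := by
  obtain ⟨τ', h1, h2, -, -, -, -, hD⟩ := h.exists_type
  obtain ⟨-, ρ, -, -, -, -, -, hD'⟩ := hτ
  have e1 : ρ = 1 / p := by
    have := hD'.1.2.symm.trans hD.1.2
    exact_mod_cast this
  subst e1
  have e2 : τ = τ' := by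
    have := hD'.2.symm.trans hD.2
    exact_mod_cast this
  rw [e2]
  exact ⟨h1, h2⟩

end Admissible

theorem lowerBound_pos {p : ℕ} (hp : 3 ≤ p) : 0 < lowerBound p :=
  div_pos Real.pi_pos (mul_pos (by exact_mod_cast (by omega : 0 < p)) (sin_pi_div_pos hp))

theorem lowerBound_eq_upperBound_mul_cos {p : ℕ} (hp : 3 ≤ p) :
    lowerBound p = upperBound p * Real.cos (Real.pi / p) := by
  have h1 := sin_pi_div_pos hp
  have h2 := cos_pi_div_pos hp
  have hp0 : (0 : ℝ) < p := by exact_mod_cast (by omega : 0 < p)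
  rw [lowerBound, upperBound]
  field_simp

/-- Two numbers in `[hi * c, hi]` have a quotient between `c` and `1 / c`, so uniformity needs only
`c` close to 1. -/
theorem abs_div_sub_one_lt {lo hi c ε a b : ℝ} (hlo : 0 < lo) (hc : 0 < c) (hlohi : lo = hi * c)
    (hε : 1 < (1 + ε) * c) (hε' : 1 - ε < c) (ha : lo ≤ a ∧ a ≤ hi) (hb : lo ≤ b ∧ b ≤ hi) :
    |a / b - 1| < ε := by
  have hb0 : 0 < b := hlo.trans_le hb.1
  have hhi : 0 < hi := by
    by_contra hn
    nlinarith
  have h1 : a / b < 1 + ε := by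
    rw [div_lt_iff₀ hb0]
    have : 0 < 1 + ε := by
      by_contra hn
      nlinarith
    nlinarith
  have h2 : 1 - ε < a / b := by
    rw [lt_div_iff₀ hb0]
    have : (1 - ε) * b < c * b := by gcongr
    nlinarith
  rw [abs_lt]
  constructor <;> linarith

theorem eventually_cos_pi_div {ε : ℝ} (hε : 0 < ε) : ∀ᶠ p : ℕ in atTop,
    1 < (1 + ε) * Real.cos (Real.pi / p) ∧ 1 - ε < Real.cos (Real.pi / p) := by
  have h1 : Tendsto (fun p : ℕ => Real.cos (Real.pi / p)) atTop (𝓝 1) := by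
    have := (Real.continuous_cos.tendsto 0).comp (tendsto_const_div_atTop_nhds_zero_nat Real.pi)
    rwa [Real.cos_zero] at this
  have h2 : Tendsto (fun p : ℕ => (1 + ε) * Real.cos (Real.pi / p)) atTop (𝓝 (1 + ε)) := by
    simpa using h1.const_mul (1 + ε)
  exact (h2.eventually (lt_mem_nhds (by linarith))).and (h1.eventually (lt_mem_nhds (by linarith)))

end

end ValentMoment

end

/-! ### The main theorem. -/

theorem mainTheorem4 :
    -- order and type of the moment problem, with the two bounds
    (∀ (p : ℕ) (e d : Fin p → ℝ), ValentMoment.Admissible p e d →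
      ValentMoment.HasMomentOrder
          (ValentMoment.jacobiA p e d) (ValentMoment.jacobiB p e d) (1 / (p : ℝ)) ∧
      ∃ τ : ℝ,
        ValentMoment.HasMomentType
          (ValentMoment.jacobiA p e d) (ValentMoment.jacobiB p e d) (τ : EReal) ∧
        ValentMoment.lowerBound p ≤ τ ∧ τ ≤ ValentMoment.upperBound p) ∧
    -- the conjectured value lies between the same bounds
    (∀ p : ℕ, 3 ≤ p →
      IntervalIntegrable (ValentMoment.valentIntegrand p) MeasureTheory.volume 0 1 ∧
      ValentMoment.lowerBound p ≤ ValentMoment.valentIntegral p ∧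
      ValentMoment.valentIntegral p ≤ ValentMoment.upperBound p) ∧
    -- the conjectured value is asymptotically correct, uniformly in the parameters
    (∀ ε : ℝ, 0 < ε → ∃ p₀ : ℕ, ∀ p : ℕ, p₀ ≤ p →
      ∀ e d : Fin p → ℝ, ValentMoment.Admissible p e d →
        ∀ τ : ℝ,
          ValentMoment.HasMomentType
            (ValentMoment.jacobiA p e d) (ValentMoment.jacobiB p e d) (τ : EReal) →
          |τ / ValentMoment.valentIntegral p - 1| < ε) := by
  refine ⟨fun p e d h => ?_, fun p hp => ⟨?_, ValentMoment.lowerBound_le_valentIntegral hp,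
    ValentMoment.valentIntegral_le_upperBound hp⟩, fun ε hε => ?_⟩
  · obtain ⟨τ, h1, h2, hI, hA, hB, hC, hD⟩ := h.exists_type
    have hp : (3 : ℝ) ≤ p := by exact_mod_cast h.three_le
    exact ⟨⟨hI, hA.1, hB.1, hC.1, hD.1⟩, τ, ⟨hI, 1 / p, by positivity,
      (div_lt_one (by linarith)).2 (by linarith), hA, hB, hC, hD⟩, h1, h2⟩
  · rw [intervalIntegrable_iff_integrableOn_Ioo_of_le zero_le_one]
    exact ValentMoment.valentIntegrand_integrableOn hp
  · obtain ⟨p₀, hp₀⟩ := eventually_atTop.1 (ValentMoment.eventually_cos_pi_div hε)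
    refine ⟨p₀, fun p hpp e d h τ hτ => ?_⟩
    have hp := h.three_le
    exact ValentMoment.abs_div_sub_one_lt (ValentMoment.lowerBound_pos hp)
      (ValentMoment.cos_pi_div_pos hp) (ValentMoment.lowerBound_eq_upperBound_mul_cos hp)
      (hp₀ p hpp).1 (hp₀ p hpp).2 (h.type_mem hτ)
      ⟨ValentMoment.lowerBound_le_valentIntegral hp, ValentMoment.valentIntegral_le_upperBound hp⟩
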